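/- Let $\mathsf{PaB}$ be the operad (in groupoids) of parenthesized braids and $\widehat{\mathsf{PaB}}$ its profinite completion, obtained by replacing each groupoid $\mathsf{PaB}(n)$ by the limit of its finite quotients. Let $\widehat{\mathsf{GT}}=\mathrm{Aut}(\widehat{\mathsf{PaB}})$ be the group of continuous automorphisms of the operad $\widehat{\mathsf{PaB}}$ that are the identity on objects. Let $\beta\in\mathsf{PaB}(2)$ be the braiding from $1\,2$ to $2\,1$ (given by the generator $\sigma_1$ of the braid group $\mathrm{B}_2$) and $\alpha\in\mathsf{PaB}(3)$ the associator from $(1\,2)3$ to $1(2\,3)$ (given by the trivial braid). The automorphism group of $1\,2$ in $\widehat{\mathsf{PaB}}(2)$ is $\widehat{\mathrm{PB}}_2=\overline{\langle x_{12}\rangle}\cong\widehat{\mathbb Z}$, and the automorphism group of $(1\,2)3$ in $\widehat{\mathsf{PaB}}(3)$ is the profinite completion $\widehat{\mathrm{PB}}_3$ of the pure braid group $\mathrm{PB}_3$. Hence every $\hat T\in\widehat{\mathsf{GT}}$ determines a pair $(\hat m,\hat f)\in\widehat{\mathbb Z}\times\widehat{\mathrm{PB}}_3$ by $$\hat T(\beta)=\beta\cdot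 x_{12}^{\hat m},\qquad \hat T(\alpha)=\alpha\cdot\hat f .$$ Let $\mathsf F_2$ be the free group on $x,y$, with profinite completion $\widehat{\mathsf F}_2$, and let $\widehat{\mathsf F}_2\to\widehat{\mathrm{PB}}_3$ be the continuous homomorphism with $x\mapsto x_{12}=\sigma_1^2$, $y\mapsto x_{23}=\sigma_2^2$, through which $\widehat{\mathsf F}_2$ is identified with the closure of $\langle x_{12},x_{23}\rangle$ in $\widehat{\mathrm{PB}}_3$. Then for every $\hat T\in\widehat{\mathsf{GT}}$, with corresponding pair $(\hat m,\hat f)$, the element $\hat f$ is the image of an element of the topological closure of the commutator subgroup $[\widehat{\mathsf F}_2,\widehat{\mathsf F}_2]$ of $\widehat{\mathsf F}_2$. -/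

import Mathlib

open CategoryTheory
open scoped CategoryTheory.Prod

namespace GTHatPaB

/-! ## Artin braid groups

Strands are numbered from `0`, so the generator with index `i` crosses the strands in the
positions `i` and `i + 1`. Products are read from right to left. -/

/-- Artin's relations on the generators `σ_0, …, σ_{n-2}`. -/
def braidRels (n : ℕ) : Set (FreeGroup (Fin (n - 1))) :=
  {r | ∃ i j : Fin (n - 1), (i : ℕ) + 2 ≤ j ∧
    r = FreeGroup.of i * FreeGroup.of j * (FreeGroup.of i)⁻¹ * (FreeGroup.of j)⁻¹} ∪
  {r | ∃ i j : Fin (n - 1), (i : ℕ) + 1 = j ∧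
    r = FreeGroup.of i * FreeGroup.of j * FreeGroup.of i *
      (FreeGroup.of j)⁻¹ * (FreeGroup.of i)⁻¹ * (FreeGroup.of j)⁻¹}

/-- The Artin braid group on `n` strands. -/
abbrev Braid (n : ℕ) : Type := PresentedGroup (braidRels n)

/-- The standard generator crossing the positions `j` and `j + 1` (for `j + 1 < n`; the value is
`1` for other `j`). -/
def sigma (n j : ℕ) : Braid n :=
  if h : j < n - 1 then PresentedGroup.of ⟨j, h⟩ else 1

/-- The elements `s 0, …, s (N - 1)` of a group satisfy Artin's relations. -/
structure IsBraiding {G : Type*} [Group G] (s : ℕ → G) (N : ℕ) : Prop where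
  far : ∀ i j, i + 2 ≤ j → j < N → s i * s j = s j * s i
  near : ∀ i, i + 1 < N → s i * s (i + 1) * s i = s (i + 1) * s i * s (i + 1)

theorem sigma_isBraiding (n : ℕ) : IsBraiding (sigma n) (n - 1) where
  far i j hij hj := by
    have hi : i < n - 1 := by omega
    have h : (PresentedGroup.mk (braidRels n)) (FreeGroup.of ⟨i, hi⟩ * FreeGroup.of ⟨j, hj⟩ *
        (FreeGroup.of ⟨i, hi⟩)⁻¹ * (FreeGroup.of ⟨j, hj⟩)⁻¹) = 1 :=
      PresentedGroup.one_of_mem (Or.inl ⟨_, _, hij, rfl⟩)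
    simp only [sigma, hi, hj, dif_pos]
    simp only [map_mul, map_inv] at h
    rw [mul_inv_eq_one, mul_inv_eq_iff_eq_mul] at h
    exact h
  near i hj := by
    have hi : i < n - 1 := by omega
    have h : (PresentedGroup.mk (braidRels n)) (FreeGroup.of ⟨i, hi⟩ * FreeGroup.of ⟨i + 1, hj⟩ *
        FreeGroup.of ⟨i, hi⟩ * (FreeGroup.of ⟨i + 1, hj⟩)⁻¹ * (FreeGroup.of ⟨i, hi⟩)⁻¹ *
        (FreeGroup.of ⟨i + 1, hj⟩)⁻¹) = 1 :=
      PresentedGroup.one_of_mem (Or.inr ⟨_, _, rfl, rfl⟩)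
    simp only [sigma, hi, hj, dif_pos]
    simp only [map_mul, map_inv] at h
    rw [mul_inv_eq_one, mul_inv_eq_iff_eq_mul, mul_inv_eq_iff_eq_mul] at h
    exact h

/-- The universal property of the braid group. -/
def Braid.lift {G : Type*} [Group G] {n : ℕ} (s : ℕ → G) (hs : IsBraiding s (n - 1)) :
    Braid n →* G :=
  PresentedGroup.toGroup (f := fun i : Fin (n - 1) => s i) (by
    rintro r (⟨i, j, hij, rfl⟩ | ⟨i, j, hij, rfl⟩)
    · simp only [map_mul, map_inv, FreeGroup.lift_apply_of]
      rw [mul_inv_eq_one, mul_inv_eq_iff_eq_mul]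
      exact hs.far i j hij j.2
    · simp only [map_mul, map_inv, FreeGroup.lift_apply_of]
      rw [mul_inv_eq_one, mul_inv_eq_iff_eq_mul, mul_inv_eq_iff_eq_mul, ← hij]
      exact hs.near i (by omega))

theorem Braid.lift_sigma {G : Type*} [Group G] {n : ℕ} (s : ℕ → G) (hs : IsBraiding s (n - 1))
    {j : ℕ} (hj : j < n - 1) : Braid.lift s hs (sigma n j) = s j := by
  simp only [sigma, hj, dif_pos]
  exact PresentedGroup.toGroup.of _

theorem Braid.induction {n : ℕ} {P : Braid n → Prop} (one : P 1)
    (gen : ∀ j, j < n - 1 → P (sigma n j)) (mul : ∀ g h, P g → P h → P (g * h))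
    (inv : ∀ g, P g → P g⁻¹) (g : Braid n) : P g := by
  refine PresentedGroup.generated_by (braidRels n)
    { carrier := {g | P g}, mul_mem' := fun {a b} ha hb => mul a b ha hb, one_mem' := one,
      inv_mem' := fun {a} ha => inv a ha } (fun j => ?_) g
  have h := gen j j.2
  simpa [sigma] using h

/-! ### Crossing one strand with several parallel strands -/

section Crossings

variable {G : Type*} [Group G]

/-- `s j * s (j + 1) * ⋯ * s (j + m - 1)`: the `m` parallel strands in the positions
`j, …, j + m - 1` cross over the strand in position `j + m`. -/
def blockOver (s : ℕ → G) (j : ℕ) : ℕ → G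
  | 0 => 1
  | m + 1 => blockOver s j m * s (j + m)

/-- `s (j + m - 1) * ⋯ * s (j + 1) * s j`: the strand in position `j` crosses over the `m`
parallel strands in the positions `j + 1, …, j + m`. -/
def blockUnder (s : ℕ → G) (j : ℕ) : ℕ → G
  | 0 => 1
  | m + 1 => s (j + m) * blockUnder s j m

variable {s : ℕ → G} {N : ℕ}

theorem IsBraiding.inv (hs : IsBraiding s N) : IsBraiding (fun i => (s i)⁻¹) N where
  far i j hij hj := by
    have := hs.far i j hij hj
    rw [← mul_inv_rev, ← mul_inv_rev, this]
  near i hi := by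
    have := hs.near i hi
    simp only [← mul_inv_rev, ← mul_assoc, this]

theorem blockOver_inv (s : ℕ → G) (j m : ℕ) :
    blockOver (fun i => (s i)⁻¹) j m = (blockUnder s j m)⁻¹ := by
  induction m with
  | zero => simp [blockOver, blockUnder]
  | succ m ih => simp [blockOver, blockUnder, ih]

theorem IsBraiding.over_far_above (hs : IsBraiding s N) (j m k : ℕ) (h : j + m + 1 ≤ k)
    (hk : k < N) : s k * blockOver s j m = blockOver s j m * s k := by
  induction m with
  | zero => simp [blockOver]
  | succ m ih =>
    have h1 := hs.far (j + m) k (by omega) hk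
    rw [blockOver, ← mul_assoc, ih (by omega), mul_assoc, mul_assoc, h1]

theorem IsBraiding.over_far_below (hs : IsBraiding s N) (j m k : ℕ) (h : k + 2 ≤ j)
    (hk : j + m ≤ N) : s k * blockOver s j m = blockOver s j m * s k := by
  induction m with
  | zero => simp [blockOver]
  | succ m ih =>
    have h1 := hs.far k (j + m) (by omega) (by omega)
    rw [blockOver, ← mul_assoc, ih (by omega), mul_assoc, mul_assoc, h1]

theorem IsBraiding.over_shift (hs : IsBraiding s N) (j m t : ℕ) (ht : t + 1 < m)
    (hm : j + m ≤ N) : s (j + t + 1) * blockOver s j m = blockOver s j m * s (j + t) := by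
  induction m with
  | zero => omega
  | succ m ih =>
    rcases Nat.lt_or_ge (t + 1) m with h | h
    · have h1 := hs.far (j + t) (j + m) (by omega) (by omega)
      rw [blockOver, ← mul_assoc, ih h (by omega), mul_assoc, mul_assoc, h1]
    · obtain rfl : m = t + 1 := by omega
      have h1 := hs.near (j + t) (by omega)
      have h2 := hs.over_far_above j t (j + t + 1) (by omega) (by omega)
      simp only [blockOver, ← add_assoc]
      calc s (j + t + 1) * (blockOver s j t * s (j + t) * s (j + t + 1))
          = (s (j + t + 1) * blockOver s j t) * s (j + t) * s (j + t + 1) := by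
            simp only [mul_assoc]
        _ = blockOver s j t * (s (j + t + 1) * s (j + t) * s (j + t + 1)) := by
            rw [h2]; simp only [mul_assoc]
        _ = _ := by rw [← h1]; simp only [mul_assoc]

theorem IsBraiding.over_over (hs : IsBraiding s N) (i m : ℕ) (hm : i + m < N) :
    s i * (blockOver s (i + 1) m * blockOver s i m) =
      blockOver s (i + 1) m * blockOver s i m * s (i + m) := by
  induction m with
  | zero => simp [blockOver]
  | succ m ih =>
    have h1 := hs.over_far_above i m (i + m + 1) (by omega) (by omega)
    have h2 := hs.near (i + m) (by omega)
    have e : blockOver s (i + 1) (m + 1) * blockOver s i (m + 1) =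
        blockOver s (i + 1) m * blockOver s i m * (s (i + m + 1) * s (i + m)) := by
      simp only [blockOver, show i + 1 + m = i + m + 1 by omega]
      calc _ = blockOver s (i + 1) m * (s (i + m + 1) * blockOver s i m) * s (i + m) := by
            simp only [mul_assoc]
        _ = _ := by rw [h1]; simp only [mul_assoc]
    rw [e, ← mul_assoc, ih (by omega)]
    calc _ = blockOver s (i + 1) m * blockOver s i m *
          (s (i + m) * s (i + m + 1) * s (i + m)) := by simp only [mul_assoc]
      _ = _ := by rw [h2]; simp only [mul_assoc, add_assoc]

theorem IsBraiding.under_far_above (hs : IsBraiding s N) (j m k : ℕ) (h : j + m + 1 ≤ k)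
    (hk : k < N) : s k * blockUnder s j m = blockUnder s j m * s k := by
  have := congrArg Inv.inv (hs.inv.over_far_above j m k h hk)
  simpa [blockOver_inv] using this.symm

theorem IsBraiding.under_far_below (hs : IsBraiding s N) (j m k : ℕ) (h : k + 2 ≤ j)
    (hk : j + m ≤ N) : s k * blockUnder s j m = blockUnder s j m * s k := by
  have := congrArg Inv.inv (hs.inv.over_far_below j m k h hk)
  simpa [blockOver_inv] using this.symm

theorem IsBraiding.under_shift (hs : IsBraiding s N) (j m t : ℕ) (ht : t + 1 < m)
    (hm : j + m ≤ N) : s (j + t) * blockUnder s j m = blockUnder s j m * s (j + t + 1) := by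
  have := congrArg Inv.inv (hs.inv.over_shift j m t ht hm)
  simpa [blockOver_inv] using this.symm

theorem IsBraiding.under_under (hs : IsBraiding s N) (i m : ℕ) (hm : i + m < N) :
    s (i + m) * (blockUnder s i m * blockUnder s (i + 1) m) =
      blockUnder s i m * blockUnder s (i + 1) m * s i := by
  have := congrArg Inv.inv (hs.inv.over_over i m hm)
  simpa [blockOver_inv, mul_assoc] using this.symm

theorem IsBraiding.over_under (hs : IsBraiding s N) (i m : ℕ) (hm : i + m < N) :
    blockOver s i m * s (i + m) * blockUnder s i m =
      blockUnder s (i + 1) m * s i * blockOver s (i + 1) m := by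
  induction m with
  | zero => simp [blockOver, blockUnder]
  | succ m ih =>
    have h1 := hs.over_far_above i m (i + m + 1) (by omega) (by omega)
    have h2 := hs.under_far_above i m (i + m + 1) (by omega) (by omega)
    have h3 := hs.near (i + m) (by omega)
    simp only [blockOver, blockUnder, show i + 1 + m = i + m + 1 by omega, ← add_assoc]
    calc _ = blockOver s i m * (s (i + m) * s (i + m + 1) * s (i + m)) * blockUnder s i m := by
          simp only [mul_assoc]
      _ = (blockOver s i m * s (i + m + 1)) * s (i + m) * (s (i + m + 1) * blockUnder s i m) := by
          rw [h3]; simp only [mul_assoc]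
      _ = s (i + m + 1) * (blockOver s i m * s (i + m) * blockUnder s i m) * s (i + m + 1) := by
          rw [h2, ← h1]; simp only [mul_assoc]
      _ = _ := by rw [ih (by omega)]; simp only [mul_assoc]

end Crossings

/-! ### The underlying permutation -/

/-- The transposition of the positions `j` and `j + 1`. -/
def adjSwap (n j : ℕ) : Equiv.Perm (Fin n) :=
  if h : j + 1 < n then Equiv.swap ⟨j, by omega⟩ ⟨j + 1, h⟩ else 1

theorem adjSwap_val {n j : ℕ} (h : j + 1 < n) (k : Fin n) :
    (adjSwap n j k : ℕ) = if (k : ℕ) = j then j + 1 else if (k : ℕ) = j + 1 then j else k := by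
  simp only [adjSwap, h, dif_pos, Equiv.swap_apply_def, Fin.ext_iff]
  split_ifs <;> rfl

theorem adjSwap_isBraiding (n : ℕ) : IsBraiding (adjSwap n) (n - 1) where
  far i j hij hj := by
    ext k
    simp only [Equiv.Perm.mul_apply, adjSwap_val (show i + 1 < n by omega),
      adjSwap_val (show j + 1 < n by omega)]
    split_ifs <;> omega
  near i hi := by
    ext k
    simp only [Equiv.Perm.mul_apply, adjSwap_val (show i + 1 < n by omega),
      adjSwap_val (show i + 1 + 1 < n by omega)]
    split_ifs <;> omega

/-- The standard homomorphism to the symmetric group: the strand that starts in position `k`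
ends in position `braidPerm n g k`. -/
def braidPerm (n : ℕ) : Braid n →* Equiv.Perm (Fin n) :=
  Braid.lift (adjSwap n) (adjSwap_isBraiding n)

theorem braidPerm_sigma_val {n j : ℕ} (h : j + 1 < n) (k : Fin n) :
    (braidPerm n (sigma n j) k : ℕ) =
      if (k : ℕ) = j then j + 1 else if (k : ℕ) = j + 1 then j else k := by
  rw [braidPerm, Braid.lift_sigma _ _ (by omega), adjSwap_val h]

/-- The pure braid group on `n` strands. -/
def PureBraid (n : ℕ) : Subgroup (Braid n) := (braidPerm n).ker

/-! ### Insertion of a braid and cabling of a strand -/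

/-- The braid on `n + m` strands that performs a given braid on the `m` strands in the positions
`k, …, k + m - 1` and leaves the others alone. -/
def insertBraid (n m : ℕ) (k : Fin (n + 1)) : Braid m →* Braid (n + m) :=
  Braid.lift (fun t => sigma (n + m) (k + t))
    { far := fun i j hij hj => (sigma_isBraiding (n + m)).far _ _ (by omega) (by omega)
      near := fun i hi => by
        simpa only [add_assoc] using (sigma_isBraiding (n + m)).near (k + i) (by omega) }

/-- The result of replacing, in the generator `sigma (n + 1) j`, the strand that starts in
position `k` by `m` parallel strands. -/
def cabledSigma (n m j k : ℕ) : Braid (n + m) :=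
  if k < j then sigma (n + m) (j - 1 + m)
  else if k = j then blockOver (sigma (n + m)) j m
  else if k = j + 1 then blockUnder (sigma (n + m)) j m
  else sigma (n + m) j

/-- The action of the generator with index `j` on pairs consisting of a position of the strand to
be cabled and an already cabled braid. -/
def cablePerm (n m j : ℕ) : Equiv.Perm (Fin (n + 1) × Braid (n + m)) where
  toFun p := (adjSwap (n + 1) j p.1, cabledSigma n m j p.1 * p.2)
  invFun p := ((adjSwap (n + 1) j)⁻¹ p.1,
    (cabledSigma n m j ((adjSwap (n + 1) j)⁻¹ p.1 : Fin (n + 1)))⁻¹ * p.2)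
  left_inv p := by simp
  right_inv p := by simp

theorem cablePerm_isBraiding (n m : ℕ) : IsBraiding (cablePerm n m) (n + 1 - 1) where
  far i j hij hj := by
    have hs := sigma_isBraiding (n + m)
    refine Equiv.ext fun ⟨k, b⟩ => Prod.ext ?_ ?_
    · exact congrArg (fun e => e k) ((adjSwap_isBraiding (n + 1)).far i j hij hj)
    · simp only [Equiv.Perm.mul_apply, cablePerm, Equiv.coe_fn_mk,
        adjSwap_val (show i + 1 < n + 1 by omega), adjSwap_val (show j + 1 < n + 1 by omega),
        ← mul_assoc]
      congr 1
      rcases Nat.lt_trichotomy k i with h | h | h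
      · simp [cabledSigma, show (k : ℕ) ≠ i by omega, show (k : ℕ) ≠ j by omega,
          show (k : ℕ) ≠ i + 1 by omega, show (k : ℕ) ≠ j + 1 by omega, h,
          show (k : ℕ) < j by omega]
        exact hs.far _ _ (by omega) (by omega)
      · simp [cabledSigma, show i + 1 < j by omega, show i < j by omega, show i ≠ j by omega, h,
          show i ≠ j + 1 by omega]
        exact (hs.over_far_above _ _ _ (by omega) (by omega)).symm
      · rcases Nat.lt_trichotomy k (i + 1) with h' | h' | h'
        · omega
        · simp [cabledSigma, show i + 1 < j by omega, show i < j by omega, show i ≠ j by omega, h',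
            show i + 1 ≠ j by omega]
          exact (hs.under_far_above _ _ _ (by omega) (by omega)).symm
        · rcases Nat.lt_trichotomy k j with h2 | h2 | h2
          · simp [cabledSigma, show (k : ℕ) ≠ i by omega, show (k : ℕ) ≠ j by omega,
              show (k : ℕ) ≠ i + 1 by omega, show (k : ℕ) ≠ j + 1 by omega, h2,
              show ¬ (k : ℕ) < i by omega]
            exact hs.far _ _ (by omega) (by omega)
          · simp [cabledSigma, show j ≠ i by omega, show j ≠ i + 1 by omega, h2,
              show ¬ j < i by omega, show ¬ j + 1 < i by omega, show j + 1 ≠ i by omega]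
            exact hs.over_far_below _ _ _ (by omega) (by omega)
          · rcases Nat.lt_trichotomy k (j + 1) with h3 | h3 | h3
            · omega
            · simp [cabledSigma, show j ≠ i by omega, show j ≠ i + 1 by omega, h3,
                show ¬ j < i by omega, show ¬ j + 1 < i by omega, show j + 1 ≠ i by omega]
              exact hs.under_far_below _ _ _ (by omega) (by omega)
            · simp [cabledSigma, show (k : ℕ) ≠ i by omega, show (k : ℕ) ≠ j by omega,
                show (k : ℕ) ≠ i + 1 by omega, show (k : ℕ) ≠ j + 1 by omega,
                show ¬ (k : ℕ) < i by omega, show ¬ (k : ℕ) < j by omega]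
              exact hs.far _ _ (by omega) (by omega)
  near i hi := by
    have hs := sigma_isBraiding (n + m)
    refine Equiv.ext fun ⟨k, b⟩ => Prod.ext ?_ ?_
    · exact congrArg (fun e => e k) ((adjSwap_isBraiding (n + 1)).near i hi)
    · simp only [Equiv.Perm.mul_apply, cablePerm, Equiv.coe_fn_mk,
        adjSwap_val (show i + 1 < n + 1 by omega), adjSwap_val (show i + 1 + 1 < n + 1 by omega),
        ← mul_assoc]
      congr 1
      have h1 : ¬ i + 1 + 1 = i := by omega
      have h2 : ¬ i = i + 1 + 1 := by omega
      have h3 : ¬ i + 1 + 1 < i := by omega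
      have h4 : ¬ i + 1 + 1 ≤ i := by omega
      rcases Nat.lt_trichotomy k i with h | h | h
      · have := hs.near (i - 1 + m) (by omega)
        rw [show i - 1 + m + 1 = i + m by omega] at this
        simpa [cabledSigma, show (k : ℕ) ≠ i by omega, show (k : ℕ) ≠ i + 1 by omega,
          show (k : ℕ) ≠ i + 1 + 1 by omega, h, show (k : ℕ) < i + 1 by omega] using this
      · have := hs.over_over i m (by omega)
        simpa [cabledSigma, h, mul_assoc, h1, h2, h3, h4] using this
      · rcases Nat.lt_trichotomy k (i + 1) with h' | h' | h'
        · omega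
        · have := hs.over_under i m (by omega)
          simpa [cabledSigma, h', h1, h2, h3, h4] using this
        · rcases Nat.lt_trichotomy k (i + 1 + 1) with h5 | h5 | h5
          · omega
          · have := hs.under_under i m (by omega)
            simpa [cabledSigma, h5, mul_assoc, h1, h2, h3, h4] using this.symm
          · simpa [cabledSigma, show (k : ℕ) ≠ i by omega, show (k : ℕ) ≠ i + 1 by omega,
              show (k : ℕ) ≠ i + 1 + 1 by omega, show ¬ (k : ℕ) < i by omega,
              show ¬ (k : ℕ) ≤ i by omega,
              show ¬ (k : ℕ) < i + 1 by omega] using hs.near i (by omega)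

/-- The braid obtained from `g` by replacing the strand that starts in position `k` by `m`
parallel strands. -/
def cable (n m : ℕ) (g : Braid (n + 1)) (k : Fin (n + 1)) : Braid (n + m) :=
  (Braid.lift (cablePerm n m) (cablePerm_isBraiding n m) g (k, 1)).2

theorem cable_aux (n m : ℕ) (g : Braid (n + 1)) : ∀ (k : Fin (n + 1)) (b : Braid (n + m)),
    Braid.lift (cablePerm n m) (cablePerm_isBraiding n m) g (k, b) =
      (braidPerm (n + 1) g k, cable n m g k * b) := by
  induction g using Braid.induction with
  | one => intro k b; simp only [cable, map_one, Equiv.Perm.one_apply, one_mul]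
  | gen j hj =>
    intro k b
    rw [cable, braidPerm, Braid.lift_sigma _ _ hj, Braid.lift_sigma _ _ hj]
    simp [cablePerm]
  | mul g h hg hh =>
    intro k b
    have e : cable n m (g * h) k =
        cable n m g (braidPerm (n + 1) h k) * (cable n m h k * 1) := by
      conv_lhs => rw [cable, map_mul, Equiv.Perm.mul_apply, hh, hg]
    rw [e, map_mul, Equiv.Perm.mul_apply, hh, hg, map_mul, Equiv.Perm.mul_apply, mul_one,
      mul_assoc]
  | inv g hg =>
    intro k b
    have key : ∀ b', (Braid.lift (cablePerm n m) (cablePerm_isBraiding n m) g)⁻¹ (k, b') =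
        ((braidPerm (n + 1) g)⁻¹ k, (cable n m g ((braidPerm (n + 1) g)⁻¹ k))⁻¹ * b') := by
      intro b'
      rw [Equiv.Perm.inv_eq_iff_eq, hg]
      simp
    have e : cable n m g⁻¹ k = (cable n m g ((braidPerm (n + 1) g)⁻¹ k))⁻¹ * 1 := by
      conv_lhs => rw [cable, map_inv, key]
    rw [e, map_inv, key, map_inv, mul_one]

theorem cable_one (n m : ℕ) (k : Fin (n + 1)) : cable n m 1 k = 1 := by
  simp only [cable, map_one, Equiv.Perm.one_apply]

theorem cable_mul (n m : ℕ) (g h : Braid (n + 1)) (k : Fin (n + 1)) :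
    cable n m (g * h) k = cable n m g (braidPerm (n + 1) h k) * cable n m h k := by
  have := cable_aux n m
  conv_lhs => rw [cable, map_mul, Equiv.Perm.mul_apply, this h, this g]
  simp

theorem cable_sigma (n m : ℕ) {j : ℕ} (hj : j < n) (k : Fin (n + 1)) :
    cable n m (sigma (n + 1) j) k = cabledSigma n m j k := by
  rw [cable, Braid.lift_sigma (cablePerm n m) _ (show j < n + 1 - 1 by omega)]
  simp [cablePerm]

theorem cable_inv (n m : ℕ) (g : Braid (n + 1)) (k : Fin (n + 1)) :
    cable n m g⁻¹ k = (cable n m g (braidPerm (n + 1) g⁻¹ k))⁻¹ := by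
  have := cable_mul n m g g⁻¹ k
  rw [mul_inv_cancel, cable_one] at this
  exact (inv_eq_of_mul_eq_one_right this.symm).symm

theorem insertBraid_sigma (n m : ℕ) (k : Fin (n + 1)) {t : ℕ} (ht : t < m - 1) :
    insertBraid n m k (sigma m t) = sigma (n + m) (k + t) := by
  rw [insertBraid, Braid.lift_sigma _ _ ht]

/-- A braid inserted into a cabled strand slides along the strand. -/
theorem insertBraid_mul_cable (n m : ℕ) (g : Braid (n + 1)) : ∀ (d : Braid m) (k : Fin (n + 1)),
    insertBraid n m (braidPerm (n + 1) g k) d * cable n m g k =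
      cable n m g k * insertBraid n m k d := by
  have hs := sigma_isBraiding (n + m)
  induction g using Braid.induction with
  | one => intro d k; simp [cable_one]
  | gen j hj =>
    intro d k
    induction d using Braid.induction with
    | one => simp
    | gen t ht =>
      rw [cable_sigma n m hj, insertBraid_sigma _ _ _ ht, insertBraid_sigma _ _ _ ht,
        braidPerm_sigma_val (show j + 1 < n + 1 by omega), cabledSigma]
      rcases Nat.lt_trichotomy k j with h | h | h
      · simp only [h, if_true, show (k : ℕ) ≠ j by omega, show (k : ℕ) ≠ j + 1 by omega, if_false]
        exact hs.far _ _ (by omega) (by omega)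
      · simp only [h, lt_irrefl, if_true, if_false]
        rw [show j + 1 + t = j + t + 1 by omega]
        exact hs.over_shift _ _ _ (by omega) (by omega)
      · rcases Nat.lt_trichotomy k (j + 1) with h' | h' | h'
        · omega
        · simp only [h', if_true, show ¬ j + 1 < j by omega, show j + 1 ≠ j by omega, if_false]
          rw [show j + 1 + t = j + t + 1 by omega]
          exact hs.under_shift _ _ _ (by omega) (by omega)
        · simp only [show ¬ (k : ℕ) < j by omega, show (k : ℕ) ≠ j by omega,
            show (k : ℕ) ≠ j + 1 by omega, if_false]
          exact (hs.far _ _ (by omega) (by omega)).symm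
    | mul d e hd he => rw [map_mul, map_mul, mul_assoc, he, ← mul_assoc, hd, mul_assoc]
    | inv d hd =>
      rw [map_inv, map_inv, inv_mul_eq_iff_eq_mul, ← mul_assoc, hd, mul_inv_cancel_right]
  | mul g h hg hh =>
    intro d k
    rw [cable_mul, map_mul, Equiv.Perm.mul_apply, ← mul_assoc, hg, mul_assoc, hh, mul_assoc]
  | inv g hg =>
    intro d k
    have := hg d (braidPerm (n + 1) g⁻¹ k)
    rw [cable_inv, eq_inv_mul_iff_mul_eq, ← mul_assoc, ← this]
    simp


/-! ### Underlying permutations of inserted and cabled braids -/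

theorem insertBraid_perm_of_mem (n m : ℕ) (k : Fin (n + 1)) (d : Braid m) :
    ∀ (t : Fin m) (q : Fin (n + m)), (q : ℕ) = k + t →
      (braidPerm (n + m) (insertBraid n m k d) q : ℕ) = k + (braidPerm m d t : Fin m) := by
  induction d using Braid.induction with
  | one => intro t q h; simpa using h
  | gen j hj =>
    intro t q h
    rw [insertBraid_sigma _ _ _ hj, braidPerm_sigma_val (by omega),
      braidPerm_sigma_val (by omega), h]
    split_ifs <;> omega
  | mul d e hd he =>
    intro t q h
    rw [map_mul, map_mul, map_mul, Equiv.Perm.mul_apply, Equiv.Perm.mul_apply]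
    exact hd _ _ (he _ _ h)
  | inv d hd =>
    intro t q h
    have hlt : (k : ℕ) + (braidPerm m d⁻¹ t : Fin m) < n + m := by
      have := (braidPerm m d⁻¹ t).2
      omega
    have := hd (braidPerm m d⁻¹ t) ⟨_, hlt⟩ rfl
    rw [map_inv, map_inv]
    have e : braidPerm (n + m) (insertBraid n m k d) ⟨_, hlt⟩ = q := by
      ext
      rw [this, h]
      simp
    rw [← e]
    simp

theorem insertBraid_perm_of_notMem (n m : ℕ) (k : Fin (n + 1)) (d : Braid m) :
    ∀ q : Fin (n + m), ((q : ℕ) < k ∨ (k : ℕ) + m ≤ q) →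
      braidPerm (n + m) (insertBraid n m k d) q = q := by
  induction d using Braid.induction with
  | one => intro q h; simp
  | gen j hj =>
    intro q h
    ext
    rw [insertBraid_sigma _ _ _ hj, braidPerm_sigma_val (by omega)]
    split_ifs <;> omega
  | mul d e hd he =>
    intro q h
    rw [map_mul, map_mul, Equiv.Perm.mul_apply, he q h, hd q h]
  | inv d hd =>
    intro q h
    rw [map_inv, map_inv, Equiv.Perm.inv_eq_iff_eq, hd q h]

/-- The new position of the strand in position `p ≠ k` after the strand in position `k` has been
replaced by `m` parallel strands. -/
def shiftPos (m k p : ℕ) : ℕ := if p < k then p else p - 1 + m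

theorem blockOver_perm {N j : ℕ} (m : ℕ) (h : j + m < N) (q : Fin N) :
    (braidPerm N (blockOver (sigma N) j m) q : ℕ) =
      if (q : ℕ) = j + m then j else if j ≤ q ∧ (q : ℕ) < j + m then q + 1 else q := by
  induction m generalizing q with
  | zero =>
    simp only [blockOver, map_one, Equiv.Perm.one_apply]
    split_ifs <;> omega
  | succ m ih =>
    rw [blockOver, map_mul, Equiv.Perm.mul_apply, ih (by omega), braidPerm_sigma_val (by omega)]
    split_ifs <;> omega

theorem blockUnder_perm {N j : ℕ} (m : ℕ) (h : j + m < N) (q : Fin N) :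
    (braidPerm N (blockUnder (sigma N) j m) q : ℕ) =
      if (q : ℕ) = j then j + m else if j < q ∧ (q : ℕ) ≤ j + m then q - 1 else q := by
  induction m with
  | zero =>
    simp only [blockUnder, map_one, Equiv.Perm.one_apply]
    split_ifs <;> omega
  | succ m ih =>
    rw [blockUnder, map_mul, Equiv.Perm.mul_apply, braidPerm_sigma_val (by omega), ih (by omega)]
    split_ifs <;> omega

theorem cable_perm_of_ne (n m : ℕ) (g : Braid (n + 1)) :
    ∀ (k p : Fin (n + 1)) (q : Fin (n + m)), p ≠ k → (q : ℕ) = shiftPos m k p →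
      (braidPerm (n + m) (cable n m g k) q : ℕ) =
        shiftPos m (braidPerm (n + 1) g k : Fin (n + 1)) (braidPerm (n + 1) g p : Fin (n + 1)) := by
  induction g using Braid.induction with
  | one => intro k p q hne h; simpa [cable_one] using h
  | gen j hj =>
    intro k p q hne h
    have hne' : (p : ℕ) ≠ k := fun e => hne (Fin.ext e)
    rw [cable_sigma n m (by omega), braidPerm_sigma_val (by omega), braidPerm_sigma_val (by omega),
      cabledSigma]
    unfold shiftPos at h ⊢
    have hq := q.2
    rcases Nat.lt_trichotomy k j with h1 | h1 | h1
    · rw [if_pos h1, braidPerm_sigma_val (by omega)]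
      split_ifs at * <;> omega
    · rw [if_neg (by omega), if_pos h1, blockOver_perm _ (by omega)]
      split_ifs at * <;> omega
    · rcases Nat.lt_trichotomy k (j + 1) with h2 | h2 | h2
      · omega
      · rw [if_neg (by omega), if_neg (by omega), if_pos h2, blockUnder_perm _ (by omega)]
        split_ifs at * <;> omega
      · rw [if_neg (by omega), if_neg (by omega), if_neg (by omega),
          braidPerm_sigma_val (by omega)]
        split_ifs at * <;> omega
  | mul g h hg hh =>
    intro k p q hne hq
    rw [cable_mul, map_mul, map_mul, Equiv.Perm.mul_apply, Equiv.Perm.mul_apply,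
      Equiv.Perm.mul_apply]
    exact hg _ _ _ (fun e => hne ((braidPerm (n + 1) h).injective e)) (hh _ _ _ hne hq)
  | inv g hg =>
    intro k p q hne hq
    set k' := braidPerm (n + 1) g⁻¹ k with hk'
    set p' := braidPerm (n + 1) g⁻¹ p with hp'
    have hk : braidPerm (n + 1) g k' = k := by simp [hk']
    have hp : braidPerm (n + 1) g p' = p := by simp [hp']
    have hne' : p' ≠ k' := fun e => hne ((braidPerm (n + 1) g⁻¹).injective e)
    have hne2 : (p' : ℕ) ≠ k' := fun e => hne' (Fin.ext e)
    have hlt : shiftPos m k' p' < n + m := by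
      unfold shiftPos
      split_ifs <;> omega
    have := hg k' p' ⟨_, hlt⟩ hne' rfl
    rw [hk, hp, ← hq] at this
    rw [cable_inv, ← hk', map_inv, ← Fin.ext this]
    simp

theorem cable_perm_of_eq (n m : ℕ) (g : Braid (n + 1)) :
    ∀ (k : Fin (n + 1)) (t : ℕ) (q : Fin (n + m)), t < m → (q : ℕ) = k + t →
      (braidPerm (n + m) (cable n m g k) q : ℕ) = (braidPerm (n + 1) g k : Fin (n + 1)) + t := by
  induction g using Braid.induction with
  | one => intro k t q ht h; simpa [cable_one] using h
  | gen j hj =>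
    intro k t q ht h
    rw [cable_sigma n m (by omega), braidPerm_sigma_val (by omega), cabledSigma]
    have hq := q.2
    rcases Nat.lt_trichotomy k j with h1 | h1 | h1
    · rw [if_pos h1, braidPerm_sigma_val (by omega)]
      split_ifs at * <;> omega
    · rw [if_neg (by omega), if_pos h1, blockOver_perm _ (by omega)]
      split_ifs at * <;> omega
    · rcases Nat.lt_trichotomy k (j + 1) with h2 | h2 | h2
      · omega
      · rw [if_neg (by omega), if_neg (by omega), if_pos h2, blockUnder_perm _ (by omega)]
        split_ifs at * <;> omega
      · rw [if_neg (by omega), if_neg (by omega), if_neg (by omega),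
          braidPerm_sigma_val (by omega)]
        split_ifs at * <;> omega
  | mul g h hg hh =>
    intro k t q ht hq
    rw [cable_mul, map_mul, map_mul, Equiv.Perm.mul_apply, Equiv.Perm.mul_apply]
    exact hg _ _ _ ht (hh _ _ _ ht hq)
  | inv g hg =>
    intro k t q ht hq
    set k' := braidPerm (n + 1) g⁻¹ k with hk'
    have hk : braidPerm (n + 1) g k' = k := by simp [hk']
    have hlt : (k' : ℕ) + t < n + m := by omega
    have := hg k' t ⟨_, hlt⟩ ht rfl
    rw [hk, ← hq] at this
    rw [cable_inv, ← hk', map_inv, ← Fin.ext this]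
    simp

/-! ## Parenthesized braids -/

/-- The sequence of letters of a word of the free magma, from left to right. -/
def letters {A : Type} : FreeMagma A → List A
  | .of a => [a]
  | .mul s t => letters s ++ letters t

@[simp] theorem letters_of {A : Type} (a : A) : letters (FreeMagma.of a) = [a] := rfl

@[simp] theorem letters_mul {A : Type} (s t : FreeMagma A) :
    letters (s * t) = letters s ++ letters t := rfl

theorem letters_lift {A B : Type} (f : A → FreeMagma B) (w : FreeMagma A) :
    letters (FreeMagma.lift f w) = (letters w).flatMap fun a => letters (f a) := by
  induction w using FreeMagma.recOnMul with
  | ih1 a => simp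
  | ih2 s t hs ht => simp [map_mul, hs, ht]

theorem letters_map {A B : Type} (f : A → B) (w : FreeMagma A) :
    letters (FreeMagma.map f w) = (letters w).map f := by
  induction w using FreeMagma.recOnMul with
  | ih1 a => simp
  | ih2 s t hs ht => simp [map_mul, hs, ht]

/-- The objects of the groupoid `PaB(n)`: words of the free magma on the labels `0, …, n - 1` in
which each label appears exactly once. -/
structure PaB (n : ℕ) where
  word : FreeMagma (Fin n)
  count_eq_one : ∀ i, (letters word).count i = 1

namespace PaB

theorem ext' {n : ℕ} {a b : PaB n} (h : a.word = b.word) : a = b := by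
  cases a; cases b; cases h; rfl

variable {n : ℕ}

theorem mem (a : PaB n) (i : Fin n) : i ∈ letters a.word :=
  List.count_pos_iff.1 (by rw [a.count_eq_one]; exact one_pos)

theorem nodup (a : PaB n) : (letters a.word).Nodup :=
  List.nodup_iff_count_le_one.2 fun i => (a.count_eq_one i).le

theorem length_eq (a : PaB n) : (letters a.word).length = n := by
  have h : (letters a.word).toFinset = Finset.univ :=
    Finset.eq_univ_iff_forall.2 fun i => List.mem_toFinset.2 (a.mem i)
  rw [← List.toFinset_card_of_nodup a.nodup, h, Finset.card_univ, Fintype.card_fin]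

/-- The position of the label `i` in the object `a`. -/
def pos (a : PaB n) (i : Fin n) : Fin n :=
  ⟨(letters a.word).idxOf i, by
    conv_rhs => rw [← a.length_eq]
    exact List.idxOf_lt_length_of_mem (a.mem i)⟩

theorem pos_injective (a : PaB n) : Function.Injective a.pos := fun i _ h =>
  (List.idxOf_inj (a.mem i)).1 (Fin.ext_iff.1 h)

theorem pos_surjective (a : PaB n) : Function.Surjective a.pos :=
  Finite.surjective_of_injective a.pos_injective

/-- Morphisms from `a` to `b` are the braids in which, for each label `i`, the strand that starts
at the position of `i` in `a` ends at the position of `i` in `b`. -/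
def Hom (a b : PaB n) : Type := {g : Braid n // ∀ i, braidPerm n g (a.pos i) = b.pos i}

/-- The groupoid `PaB(n)`; the composition comes from the multiplication of braids. -/
instance : Groupoid (PaB n) where
  Hom := Hom
  id a := ⟨1, fun i => by simp⟩
  comp f g := ⟨g.1 * f.1, fun i => by rw [map_mul, Equiv.Perm.mul_apply, f.2, g.2]⟩
  inv f := ⟨f.1⁻¹, fun i => by rw [map_inv, Equiv.Perm.inv_eq_iff_eq, f.2]⟩
  id_comp f := Subtype.ext (mul_one _)
  comp_id f := Subtype.ext (one_mul _)
  assoc f g h := Subtype.ext (mul_assoc _ _ _).symm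
  inv_comp f := Subtype.ext (mul_inv_cancel _)
  comp_inv f := Subtype.ext (inv_mul_cancel _)

/-- The braid underlying a morphism. -/
def ou {a b : PaB n} (f : a ⟶ b) : Braid n := f.1

theorem ou_perm {a b : PaB n} (f : a ⟶ b) (i : Fin n) : braidPerm n (ou f) (a.pos i) = b.pos i :=
  f.2 i

/-- The morphism given by a braid. -/
def mkHom {a b : PaB n} (g : Braid n) (h : ∀ i, braidPerm n g (a.pos i) = b.pos i) : a ⟶ b :=
  ⟨g, h⟩

@[simp] theorem ou_mkHom {a b : PaB n} (g : Braid n)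
    (h : ∀ i, braidPerm n g (a.pos i) = b.pos i) : ou (mkHom g h : a ⟶ b) = g := rfl

@[simp] theorem ou_id (a : PaB n) : ou (𝟙 a) = 1 := rfl

@[simp] theorem ou_comp {a b c : PaB n} (f : a ⟶ b) (g : b ⟶ c) : ou (f ≫ g) = ou g * ou f := rfl

theorem hom_ext {a b : PaB n} {f g : a ⟶ b} (h : ou f = ou g) : f = g := Subtype.ext h

/-- The automorphism group of each object of `PaB(n)` is the pure braid group. -/
def pureEnd (a : PaB n) : PureBraid n ≃* End a where
  toFun g := mkHom g.1 fun i => by rw [show braidPerm n g.1 = 1 from g.2]; rfl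
  invFun f := ⟨ou f, Equiv.ext fun p => by
    obtain ⟨i, rfl⟩ := a.pos_surjective p
    exact ou_perm f i⟩
  left_inv _ := rfl
  right_inv _ := rfl
  map_mul' _ _ := rfl

/-! ### The action of the symmetric group -/

/-- The action of a permutation on objects replaces each label `i` by `θ i`. -/
def permObj (θ : Equiv.Perm (Fin n)) (a : PaB n) : PaB n where
  word := FreeMagma.map θ a.word
  count_eq_one i := by
    rw [letters_map, ← θ.apply_symm_apply i, List.count_map_of_injective _ _ θ.injective,
      a.count_eq_one]

theorem idxOf_map {A B : Type} [DecidableEq A] [DecidableEq B] {f : A → B}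
    (hf : Function.Injective f) (a : A) (l : List A) : (l.map f).idxOf (f a) = l.idxOf a := by
  induction l with
  | nil => rfl
  | cons b l ih => simp [List.idxOf_cons, ih, Bool.cond_eq_ite, hf.eq_iff]

theorem pos_permObj (θ : Equiv.Perm (Fin n)) (a : PaB n) (i : Fin n) :
    (permObj θ a).pos (θ i) = a.pos i := by
  ext
  simp [pos, permObj, letters_map, idxOf_map θ.injective]

/-- The action of a permutation on `PaB(n)`; it does not change the underlying braids. -/
def perm (θ : Equiv.Perm (Fin n)) : PaB n ⥤ PaB n where
  obj := permObj θ
  map {a b} f := mkHom (ou f) fun i => by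
    rw [← θ.apply_symm_apply i, pos_permObj, pos_permObj, ou_perm]
  map_id _ := rfl
  map_comp _ _ := rfl

/-! ### Insertions -/

/-- The effect on labels of the insertion of a word on `m` labels for the label `i`:
the labels below `i` are kept, those above `i` are increased by `m - 1`, and the inserted
labels are increased by `i`. -/
def insertLabel {m : ℕ} (i : Fin (n + 1)) (w : FreeMagma (Fin m)) (l : Fin (n + 1)) :
    FreeMagma (Fin (n + m)) :=
  if h : l < i then FreeMagma.of ⟨l, by omega⟩
  else if h : i < l then FreeMagma.of ⟨l - 1 + m, by omega⟩
  else FreeMagma.map (fun t : Fin m => ⟨i + t, by omega⟩) w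

/-- The label of the result of an insertion for `i` that comes from the label `l ≠ i`. -/
def outer (m : ℕ) (i l : Fin (n + 1)) (h : l ≠ i) : Fin (n + m) :=
  ⟨shiftPos m i l, by
    have : (l : ℕ) ≠ i := fun e => h (Fin.ext e)
    unfold shiftPos
    split_ifs <;> omega⟩

/-- The label of the result of an insertion for `i` that comes from the inserted label `t`. -/
def inner {m : ℕ} (i : Fin (n + 1)) (t : Fin m) : Fin (n + m) := ⟨i + t, by omega⟩

theorem inner_injective {m : ℕ} (i : Fin (n + 1)) :
    Function.Injective (inner i : Fin m → Fin (n + m)) := fun s t h => by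
  simp only [inner, Fin.mk.injEq] at h
  ext
  omega

theorem outer_injective {m : ℕ} {i l l' : Fin (n + 1)} {h : l ≠ i} {h' : l' ≠ i}
    (e : outer m i l h = outer m i l' h') : l = l' := by
  have h1 : (l : ℕ) ≠ i := fun e => h (Fin.ext e)
  have h2 : (l' : ℕ) ≠ i := fun e => h' (Fin.ext e)
  simp only [outer, shiftPos, Fin.mk.injEq] at e
  ext
  split_ifs at e <;> omega

theorem outer_ne_inner {m : ℕ} {i l : Fin (n + 1)} {h : l ≠ i} (t : Fin m) :
    outer m i l h ≠ inner i t := fun e => by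
  have h1 : (l : ℕ) ≠ i := fun e => h (Fin.ext e)
  simp only [outer, inner, shiftPos, Fin.mk.injEq] at e
  split_ifs at e <;> omega

theorem label_cases {m : ℕ} (i : Fin (n + 1)) (x : Fin (n + m)) :
    (∃ l h, x = outer m i l h) ∨ ∃ t, x = inner i t := by
  rcases Nat.lt_or_ge x i with h | h
  · refine Or.inl ⟨⟨x, by omega⟩, fun e => ?_, Fin.ext ?_⟩
    · simp only [Fin.ext_iff] at e
      omega
    · simp only [outer, shiftPos, if_pos h]
  · rcases Nat.lt_or_ge x (i + m) with h' | h'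
    · exact Or.inr ⟨⟨x - i, by omega⟩, Fin.ext (by simp only [inner]; omega)⟩
    · refine Or.inl ⟨⟨x - m + 1, by omega⟩, fun e => ?_, Fin.ext ?_⟩
      · simp only [Fin.ext_iff] at e
        omega
      · simp only [outer, shiftPos]
        rw [if_neg (by omega)]
        omega

theorem letters_insertLabel_of_ne {m : ℕ} {i l : Fin (n + 1)} (h : l ≠ i)
    (w : FreeMagma (Fin m)) : letters (insertLabel i w l) = [outer m i l h] := by
  unfold insertLabel outer shiftPos
  rcases lt_or_gt_of_ne h with h1 | h1
  · rw [dif_pos h1]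
    simp [show (l : ℕ) < i from h1]
  · rw [dif_neg (not_lt_of_gt h1), dif_pos h1]
    simp [show ¬ (l : ℕ) < i by have : (i : ℕ) < l := h1; omega]

theorem letters_insertLabel_self {m : ℕ} (i : Fin (n + 1)) (w : FreeMagma (Fin m)) :
    letters (insertLabel i w i) = (letters w).map (inner i) := by
  unfold insertLabel
  rw [dif_neg (lt_irrefl _), dif_neg (lt_irrefl _), letters_map]
  rfl

/-- The letters before and after a given label. -/
theorem exists_split (a : PaB n) (i : Fin n) :
    ∃ L R, letters a.word = L ++ i :: R ∧ i ∉ L ∧ i ∉ R := by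
  obtain ⟨L, R, h⟩ := List.append_of_mem (a.mem i)
  have := a.nodup
  rw [h, List.nodup_append] at this
  refine ⟨L, R, h, fun hi => ?_, (List.nodup_cons.1 this.2.1).1⟩
  exact this.2.2 i hi i (List.mem_cons_self) rfl

/-- Positions in a list without the label `i` after the relabelling by `outer`. -/
theorem count_flatMap_outer {m : ℕ} (i l : Fin (n + 1)) (h : l ≠ i) (w : FreeMagma (Fin m))
    (L : List (Fin (n + 1))) (hL : i ∉ L) :
    (L.flatMap fun l => letters (insertLabel i w l)).count (outer m i l h) = L.count l ∧
    (L.flatMap fun l => letters (insertLabel i w l)).idxOf (outer m i l h) = L.idxOf l ∧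
    (L.flatMap fun l => letters (insertLabel i w l)).length = L.length ∧
    (∀ t : Fin m, inner i t ∉ L.flatMap fun l => letters (insertLabel i w l)) ∧
    (outer m i l h ∈ (L.flatMap fun l => letters (insertLabel i w l)) ↔ l ∈ L) := by
  induction L with
  | nil => simp
  | cons b L ih =>
    have hb : b ≠ i := fun e => hL (e ▸ List.mem_cons_self)
    obtain ⟨h1, h2, h3, h4, h5⟩ := ih fun hi => hL (List.mem_cons_of_mem _ hi)
    have e : (outer m i b hb = outer m i l h) ↔ b = l :=
      ⟨fun e => outer_injective e, fun e => by subst e; rfl⟩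
    have e' : (outer m i l h = outer m i b hb) ↔ l = b :=
      ⟨fun e => outer_injective e, fun e => by subst e; rfl⟩
    simp only [List.flatMap_cons, letters_insertLabel_of_ne hb, List.singleton_append]
    refine ⟨?_, ?_, ?_, ?_, ?_⟩
    · simp [List.count_cons, h1, e]
    · simp [List.idxOf_cons, h2, Bool.cond_eq_ite, e]
    · simp [h3]
    · intro t ht
      rcases List.mem_cons.1 ht with ht | ht
      · exact outer_ne_inner t ht.symm
      · exact h4 t ht
    · simp only [List.mem_cons, e', h5]

theorem letters_insert {m : ℕ} {i : Fin (n + 1)} {a : PaB (n + 1)} (w : FreeMagma (Fin m))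
    {L R : List (Fin (n + 1))} (h : letters a.word = L ++ i :: R) :
    letters (FreeMagma.lift (insertLabel i w) a.word) =
      (L.flatMap fun l => letters (insertLabel i w l)) ++ ((letters w).map (inner i) ++
        R.flatMap fun l => letters (insertLabel i w l)) := by
  rw [letters_lift, h, List.flatMap_append, List.flatMap_cons, letters_insertLabel_self]

/-- Insertion of the object `b` for the label `i` of the object `a`. -/
def insertObj {m : ℕ} (i : Fin (n + 1)) (a : PaB (n + 1)) (b : PaB m) : PaB (n + m) where
  word := FreeMagma.lift (insertLabel i b.word) a.word
  count_eq_one x := by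
    obtain ⟨L, R, h, hL, hR⟩ := a.exists_split i
    rw [letters_insert b.word h, List.count_append, List.count_append]
    rcases label_cases i x with ⟨l, hl, rfl⟩ | ⟨t, rfl⟩
    · have hc := a.count_eq_one l
      rw [h, List.count_append, List.count_cons_of_ne (Ne.symm hl)] at hc
      rw [(count_flatMap_outer i l hl b.word L hL).1, (count_flatMap_outer i l hl b.word R hR).1,
        List.count_eq_zero_of_not_mem (l := (letters b.word).map (inner i)), zero_add, hc]
      intro hm
      obtain ⟨t, _, ht⟩ := List.mem_map.1 hm
      exact outer_ne_inner t ht.symm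
    · rw [List.count_map_of_injective _ _ (inner_injective i), b.count_eq_one]
      have key : ∀ S : List (Fin (n + 1)), i ∉ S →
          inner i t ∉ S.flatMap fun l => letters (insertLabel i b.word l) := by
        intro S hS ht
        obtain ⟨l, hl, ht⟩ := List.mem_flatMap.1 ht
        have hne : l ≠ i := fun e => hS (e ▸ hl)
        rw [letters_insertLabel_of_ne hne, List.mem_singleton] at ht
        exact outer_ne_inner t ht.symm
      rw [List.count_eq_zero_of_not_mem (key L hL), List.count_eq_zero_of_not_mem (key R hR)]

theorem pos_insertObj_outer {m : ℕ} (i : Fin (n + 1)) (a : PaB (n + 1)) (b : PaB m)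
    (l : Fin (n + 1)) (hl : l ≠ i) :
    ((insertObj i a b).pos (outer m i l hl) : ℕ) = shiftPos m (a.pos i) (a.pos l) := by
  obtain ⟨L, R, h, hL, hR⟩ := a.exists_split i
  obtain ⟨-, h1, h2, -, h3⟩ := count_flatMap_outer i l hl b.word L hL
  obtain ⟨-, h1', h2', -, h3'⟩ := count_flatMap_outer i l hl b.word R hR
  have hn : outer m i l hl ∉ (letters b.word).map (inner i) := fun hm => by
    obtain ⟨t, _, ht⟩ := List.mem_map.1 hm
    exact outer_ne_inner t ht.symm
  have hi : (a.pos i : ℕ) = L.length := by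
    simp [pos, h, List.idxOf_append, hL]
  rw [hi]
  simp only [insertObj, pos, letters_insert b.word h]
  rw [h]
  by_cases hlL : l ∈ L
  · rw [List.idxOf_append_of_mem (h3.2 hlL), List.idxOf_append_of_mem hlL, h1, shiftPos,
      if_pos (List.idxOf_lt_length_of_mem hlL)]
  · rw [List.idxOf_append_of_notMem (fun e => hlL (h3.1 e)), List.idxOf_append_of_notMem hn,
      List.idxOf_append_of_notMem hlL, h1', h2, List.idxOf_cons_ne _ (Ne.symm hl), shiftPos,
      if_neg (by omega), List.length_map, b.length_eq]
    omega

theorem pos_insertObj_inner {m : ℕ} (i : Fin (n + 1)) (a : PaB (n + 1)) (b : PaB m) (t : Fin m) :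
    ((insertObj i a b).pos (inner i t) : ℕ) = a.pos i + b.pos t := by
  obtain ⟨L, R, h, hL, hR⟩ := a.exists_split i
  have hn : inner i t ∉ L.flatMap fun l => letters (insertLabel i b.word l) := by
    intro ht
    obtain ⟨l, hl, ht⟩ := List.mem_flatMap.1 ht
    have hne : l ≠ i := fun e => hL (e ▸ hl)
    rw [letters_insertLabel_of_ne hne, List.mem_singleton] at ht
    exact outer_ne_inner t ht.symm
  have hlen : (L.flatMap fun l => letters (insertLabel i b.word l)).length = L.length := by
    clear hn h
    induction L with
    | nil => rfl
    | cons c L ih =>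
      have hc : c ≠ i := fun e => hL (e ▸ List.mem_cons_self)
      simp [letters_insertLabel_of_ne hc, ih fun e => hL (List.mem_cons_of_mem _ e)]
  have hi : (a.pos i : ℕ) = L.length := by
    simp [pos, h, List.idxOf_append, hL]
  rw [hi]
  simp only [insertObj, pos, letters_insert b.word h]
  rw [List.idxOf_append_of_notMem hn,
    List.idxOf_append_of_mem (List.mem_map_of_mem (b.mem t)), hlen,
    idxOf_map (inner_injective i)]

/-- The operadic insertion `∘ᵢ` for parenthesized braids. The strand of the first braid that starts
at the position of the label `i` is replaced by a thin version of the second braid. -/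
def insertion {m : ℕ} (i : Fin (n + 1)) : PaB (n + 1) × PaB m ⥤ PaB (n + m) where
  obj p := insertObj i p.1 p.2
  map {p q} f := mkHom
    (cable n m (ou f.1) (p.1.pos i) * insertBraid n m (p.1.pos i) (ou f.2)) fun x => by
      rw [map_mul, Equiv.Perm.mul_apply]
      rcases label_cases i x with ⟨l, hl, rfl⟩ | ⟨t, rfl⟩
      · have hne : p.1.pos l ≠ p.1.pos i := fun e => hl (p.1.pos_injective e)
        have hne' : (p.1.pos l : ℕ) ≠ p.1.pos i := fun e => hne (Fin.ext e)
        have h1 := pos_insertObj_outer i p.1 p.2 l hl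
        rw [insertBraid_perm_of_notMem n m (p.1.pos i) (ou f.2)]
        · ext
          rw [cable_perm_of_ne n m (ou f.1) _ _ _ hne h1, ou_perm, ou_perm,
            pos_insertObj_outer]
        · rw [h1, shiftPos]
          split_ifs <;> omega
      · have h1 := pos_insertObj_inner i p.1 p.2 t
        have h2 := insertBraid_perm_of_mem n m (p.1.pos i) (ou f.2) _ _ h1
        ext
        rw [cable_perm_of_eq n m (ou f.1) _ _ _ (Fin.is_lt _) h2, ou_perm, ou_perm,
          pos_insertObj_inner]
  map_id p := hom_ext (by simp [cable_one])
  map_comp {p q r} f g := hom_ext (by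
    simp only [ou_mkHom, ou_comp, prod_comp, cable_mul, map_mul, ou_perm]
    have := insertBraid_mul_cable n m (ou f.1) (ou g.2) (p.1.pos i)
    rw [ou_perm] at this
    simp only [mul_assoc]
    congr 1
    rw [← mul_assoc, ← this, mul_assoc])

/-! ### Finiteness -/

theorem finite_words (A : Type) [Finite A] (k : ℕ) :
    {w : FreeMagma A | (letters w).length ≤ k}.Finite := by
  induction k with
  | zero =>
    refine Set.Finite.subset Set.finite_empty fun w hw => ?_
    have : 0 < (letters w).length := by
      induction w using FreeMagma.recOnMul with
      | ih1 a => simp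
      | ih2 s t hs ht =>
        simp only [Set.mem_ofPred_eq, letters_mul, List.length_append] at hw hs ht ⊢
        have := hs (by omega)
        omega
    simp only [Set.mem_ofPred_eq] at hw
    omega
  | succ k ih =>
    have hpos : ∀ w : FreeMagma A, 0 < (letters w).length := fun w => by
      induction w using FreeMagma.recOnMul with
      | ih1 a => simp
      | ih2 s t hs ht =>
        simp only [letters_mul, List.length_append]
        omega
    refine Set.Finite.subset ((Set.finite_range FreeMagma.of).union
      (Set.Finite.image2 (fun s t => s * t) ih ih)) fun w hw => ?_
    induction w using FreeMagma.recOnMul with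
    | ih1 a => exact Or.inl ⟨a, rfl⟩
    | ih2 s t _ _ =>
      have h1 := hpos s
      have h2 := hpos t
      simp only [Set.mem_ofPred_eq, letters_mul, List.length_append] at hw
      exact Or.inr ⟨s, show _ ≤ k by omega, t, show _ ≤ k by omega, rfl⟩

instance : Finite (PaB n) := by
  have := (finite_words (Fin n) n).to_subtype
  exact Finite.of_injective
    (fun a : PaB n => (⟨a.word, a.length_eq.le⟩ : {w : FreeMagma (Fin n) | (letters w).length ≤ n}))
    fun a b h => ext' (congrArg Subtype.val h)

end PaB

/-! ## Profinite completion of groupoids -/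

/-- A compatible equivalence relation on a groupoid: parallel morphisms are identified, compatibly
with the composition, and there are finitely many equivalence classes. -/
structure CompatRel (G : Type) [Groupoid.{0} G] where
  rel : ∀ a b : G, Setoid (a ⟶ b)
  comp_left : ∀ {a b c : G} (h : a ⟶ b) {f g : b ⟶ c}, rel b c f g → rel a c (h ≫ f) (h ≫ g)
  comp_right : ∀ {a b c : G} {f g : a ⟶ b} (h : b ⟶ c), rel a b f g → rel a c (f ≫ h) (g ≫ h)
  finite : Finite (Σ p : G × G, Quotient (rel p.1 p.2))

namespace CompatRel

variable {G : Type} [Groupoid.{0} G]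

theorem comp (R : CompatRel G) {a b c : G} {f f' : a ⟶ b} {g g' : b ⟶ c} (h : R.rel a b f f')
    (h' : R.rel b c g g') : R.rel a c (f ≫ g) (f' ≫ g') :=
  (R.rel a c).trans (R.comp_right g h) (R.comp_left f' h')

theorem inv (R : CompatRel G) {a b : G} {f g : a ⟶ b} (h : R.rel a b f g) :
    R.rel b a (Groupoid.inv f) (Groupoid.inv g) := by
  have := R.comp_right (Groupoid.inv f) (R.comp_left (Groupoid.inv g) h)
  simp only [Groupoid.inv_comp, Category.assoc, Groupoid.comp_inv, Category.comp_id,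
    Category.id_comp] at this
  exact (R.rel b a).symm this

instance (R : CompatRel G) (a b : G) : Finite (Quotient (R.rel a b)) := by
  have := R.finite
  exact Finite.of_injective
    (fun x => (⟨(a, b), x⟩ : Σ p : G × G, Quotient (R.rel p.1 p.2))) fun x y h => by
      simpa using h

/-- `R ≤ S` means that `R` is finer than `S`. -/
instance : LE (CompatRel G) := ⟨fun R S => ∀ a b, R.rel a b ≤ S.rel a b⟩

/-- The projection from a finer to a coarser quotient. -/
def proj {R S : CompatRel G} (h : R ≤ S) {a b : G} : Quotient (R.rel a b) → Quotient (S.rel a b) :=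
  Quotient.map id fun _ _ hxy => h a b hxy

variable {H K : Type} [Groupoid.{0} H] [Groupoid.{0} K]

/-- The pullback of a compatible equivalence relation along a functor. -/
def comap [Finite G] (F : G ⥤ K) (R : CompatRel K) : CompatRel G where
  rel a b := (R.rel (F.obj a) (F.obj b)).comap F.map
  comp_left h _ _ hfg := by
    simp only [Setoid.comap_rel, Functor.map_comp] at hfg ⊢
    exact R.comp_left _ hfg
  comp_right h hfg := by
    simp only [Setoid.comap_rel, Functor.map_comp] at hfg ⊢
    exact R.comp_right _ hfg
  finite := by
    have : ∀ p : G × G,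
        Finite (Quotient ((R.rel (F.obj p.1) (F.obj p.2)).comap (F.map (X := p.1) (Y := p.2)))) :=
      fun p => Finite.of_injective
        (Quotient.map F.map fun _ _ h => h :
          _ → Quotient (R.rel (F.obj p.1) (F.obj p.2))) (by
        rintro ⟨x⟩ ⟨y⟩ h
        exact Quotient.sound (s := (R.rel _ _).comap F.map) (Quotient.exact (s := R.rel _ _) h))
    infer_instance

/-- For a functor of two variables and a compatible equivalence relation on its target, the
relation on the first factor: morphisms are identified if they have equivalent images together with
every identity morphism of the second factor. -/
def comapLeft [Finite G] [Finite H] (F : G × H ⥤ K) (R : CompatRel K) : CompatRel G where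
  rel a b :=
    { r := fun f g => ∀ c : H, R.rel _ _ (F.map (f ×ₘ 𝟙 c)) (F.map (g ×ₘ 𝟙 c))
      iseqv := ⟨fun _ _ => Setoid.refl' _ _, fun h c => Setoid.symm' _ (h c),
        fun h h' c => Setoid.trans' _ (h c) (h' c)⟩ }
  comp_left {x y z} h f g hfg c := by
    have e : ∀ k : y ⟶ z, h ≫ k ×ₘ 𝟙 c = (h ×ₘ 𝟙 c) ≫ (k ×ₘ 𝟙 c) := fun k => by simp
    rw [e, e, F.map_comp, F.map_comp]
    exact R.comp_left _ (hfg c)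
  comp_right {x y z f g} h hfg c := by
    have e : ∀ k : x ⟶ y, k ≫ h ×ₘ 𝟙 c = (k ×ₘ 𝟙 c) ≫ (h ×ₘ 𝟙 c) := fun k => by simp
    rw [e, e, F.map_comp, F.map_comp]
    exact R.comp_right _ (hfg c)
  finite := by
    refine @Finite.instSigma _ _ _ fun p => ?_
    refine Finite.of_injective (β := ∀ c : H, Quotient (R.rel (F.obj (p.1, c)) (F.obj (p.2, c))))
      (fun x c => Quotient.map (fun f => F.map (f ×ₘ 𝟙 c)) (fun f g h => by
        have h' : ∀ c : H, R.rel _ _ (F.map (f ×ₘ 𝟙 c)) (F.map (g ×ₘ 𝟙 c)) := h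
        exact h' c) x) ?_
    rintro ⟨x⟩ ⟨y⟩ h
    exact Quotient.sound (s := _) fun c => Quotient.exact (s := R.rel _ _) (congrFun h c)

/-- The same as `CompatRel.comapLeft` for the second factor. -/
def comapRight [Finite G] [Finite H] (F : G × H ⥤ K) (R : CompatRel K) : CompatRel H where
  rel a b :=
    { r := fun f g => ∀ c : G, R.rel _ _ (F.map (𝟙 c ×ₘ f)) (F.map (𝟙 c ×ₘ g))
      iseqv := ⟨fun _ _ => Setoid.refl' _ _, fun h c => Setoid.symm' _ (h c),
        fun h h' c => Setoid.trans' _ (h c) (h' c)⟩ }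
  comp_left {x y z} h f g hfg c := by
    have e : ∀ k : y ⟶ z, 𝟙 c ×ₘ h ≫ k = (𝟙 c ×ₘ h) ≫ (𝟙 c ×ₘ k) := fun k => by simp
    rw [e, e, F.map_comp, F.map_comp]
    exact R.comp_left _ (hfg c)
  comp_right {x y z f g} h hfg c := by
    have e : ∀ k : x ⟶ y, 𝟙 c ×ₘ k ≫ h = (𝟙 c ×ₘ k) ≫ (𝟙 c ×ₘ h) := fun k => by simp
    rw [e, e, F.map_comp, F.map_comp]
    exact R.comp_right _ (hfg c)
  finite := by
    refine @Finite.instSigma _ _ _ fun p => ?_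
    refine Finite.of_injective (β := ∀ c : G, Quotient (R.rel (F.obj (c, p.1)) (F.obj (c, p.2))))
      (fun x c => Quotient.map (fun f => F.map (𝟙 c ×ₘ f)) (fun f g h => by
        have h' : ∀ c : G, R.rel _ _ (F.map (𝟙 c ×ₘ f)) (F.map (𝟙 c ×ₘ g)) := h
        exact h' c) x) ?_
    rintro ⟨x⟩ ⟨y⟩ h
    exact Quotient.sound (s := _) fun c => Quotient.exact (s := R.rel _ _) (congrFun h c)

theorem comap_two [Finite G] [Finite H] (F : G × H ⥤ K) (R : CompatRel K) {a a' : G} {b b' : H}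
    {f f' : a ⟶ a'} {g g' : b ⟶ b'} (h : (R.comapLeft F).rel a a' f f')
    (h' : (R.comapRight F).rel b b' g g') :
    R.rel _ _ (F.map (f ×ₘ g)) (F.map (f' ×ₘ g')) := by
  have e : ∀ (f : a ⟶ a') (g : b ⟶ b'), f ×ₘ g = (f ×ₘ 𝟙 b) ≫ (𝟙 a' ×ₘ g) := fun f g => by simp
  rw [e, e f' g', F.map_comp, F.map_comp]
  exact R.comp (h b) (h' a')

/-- The composition in the quotient. -/
def qcomp (R : CompatRel G) {a b c : G} :
    Quotient (R.rel a b) → Quotient (R.rel b c) → Quotient (R.rel a c) :=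
  Quotient.map₂ (fun f g => f ≫ g) fun _ _ h _ _ h' => R.comp h h'

/-- The inverse in the quotient. -/
def qinv (R : CompatRel G) {a b : G} : Quotient (R.rel a b) → Quotient (R.rel b a) :=
  Quotient.map Groupoid.inv fun _ _ h => R.inv h

/-- The map of quotients induced by a functor. -/
def qmap [Finite G] (F : G ⥤ K) (R : CompatRel K) {a b : G} :
    Quotient ((R.comap F).rel a b) → Quotient (R.rel (F.obj a) (F.obj b)) :=
  Quotient.map F.map fun _ _ h => h

/-- The map of quotients induced by a functor of two variables. -/
def qmap₂ [Finite G] [Finite H] (F : G × H ⥤ K) (R : CompatRel K) {a a' : G} {b b' : H} :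
    Quotient ((R.comapLeft F).rel a a') → Quotient ((R.comapRight F).rel b b') →
      Quotient (R.rel (F.obj (a, b)) (F.obj (a', b'))) :=
  Quotient.map₂ (fun f g => F.map (f ×ₘ g)) fun _ _ h _ _ h' => R.comap_two F h h'

end CompatRel

/-- The profinite completion of a groupoid with finitely many objects. It has the same objects. -/
structure ProCompletion (G : Type) where
  obj : G

namespace ProCompletion

variable {G H K : Type} [Groupoid.{0} G] [Groupoid.{0} H] [Groupoid.{0} K]

/-- The morphisms of the profinite completion are the elements of the limit of the sets of morphisms
of the finite quotients. -/
@[ext] structure Hom (a b : ProCompletion G) : Type where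
  component : ∀ R : CompatRel G, Quotient (R.rel a.obj b.obj)
  proj_component : ∀ {R S : CompatRel G} (h : R ≤ S),
    CompatRel.proj h (component R) = component S

/-- The composition is componentwise. -/
instance : Groupoid (ProCompletion G) where
  Hom := Hom
  id a := ⟨fun _ => ⟦𝟙 a.obj⟧, fun _ => rfl⟩
  comp x y := ⟨fun R => R.qcomp (x.component R) (y.component R), fun {R S} h => by
    rw [← x.proj_component h, ← y.proj_component h]
    induction x.component R using Quotient.ind
    induction y.component R using Quotient.ind
    rfl⟩
  inv x := ⟨fun R => R.qinv (x.component R), fun {R S} h => by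
    rw [← x.proj_component h]
    induction x.component R using Quotient.ind
    rfl⟩
  id_comp x := Hom.ext (funext fun R => by
    dsimp only
    induction x.component R using Quotient.ind
    exact congrArg (Quotient.mk _) (Category.id_comp _))
  comp_id x := Hom.ext (funext fun R => by
    dsimp only
    induction x.component R using Quotient.ind
    exact congrArg (Quotient.mk _) (Category.comp_id _))
  assoc x y z := Hom.ext (funext fun R => by
    dsimp only
    induction x.component R using Quotient.ind
    induction y.component R using Quotient.ind
    induction z.component R using Quotient.ind
    exact congrArg (Quotient.mk _) (Category.assoc _ _ _))
  inv_comp x := Hom.ext (funext fun R => by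
    dsimp only
    induction x.component R using Quotient.ind
    exact congrArg (Quotient.mk _) (Groupoid.inv_comp _))
  comp_inv x := Hom.ext (funext fun R => by
    dsimp only
    induction x.component R using Quotient.ind
    exact congrArg (Quotient.mk _) (Groupoid.comp_inv _))

/-- The component of a morphism in a finite quotient. -/
def component {a b : ProCompletion G} (x : a ⟶ b) (R : CompatRel G) :
    Quotient (R.rel a.obj b.obj) := Hom.component x R

theorem proj_component {a b : ProCompletion G} (x : a ⟶ b) {R S : CompatRel G} (h : R ≤ S) :
    CompatRel.proj h (component x R) = component x S := Hom.proj_component x h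

theorem hom_ext {a b : ProCompletion G} {x y : a ⟶ b} (h : ∀ R, component x R = component y R) :
    x = y := Hom.ext (funext h)

@[simp] theorem component_id (a : ProCompletion G) (R : CompatRel G) :
    component (𝟙 a) R = ⟦𝟙 a.obj⟧ := rfl

@[simp] theorem component_comp {a b c : ProCompletion G} (x : a ⟶ b) (y : b ⟶ c)
    (R : CompatRel G) : component (x ≫ y) R = R.qcomp (component x R) (component y R) := rfl

/-- The topology of the limit of finite discrete spaces. -/
instance (a b : ProCompletion G) : TopologicalSpace (a ⟶ b) :=
  ⨅ R : CompatRel G, TopologicalSpace.induced (fun x => component x R) ⊥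

/-- The canonical functor from a groupoid to its profinite completion. -/
def eta : G ⥤ ProCompletion G where
  obj a := ⟨a⟩
  map f := { component := fun _ => ⟦f⟧, proj_component := fun _ => rfl }
  map_id _ := rfl
  map_comp _ _ := rfl

/-- The continuous extension of a functor to the profinite completions. -/
def map [Finite G] (F : G ⥤ K) : ProCompletion G ⥤ ProCompletion K where
  obj a := ⟨F.obj a.obj⟩
  map x :=
    { component := fun R => R.qmap F (component x (R.comap F))
      proj_component := fun {R S} h => by
        have h' : R.comap F ≤ S.comap F := fun a b f g hfg => h _ _ hfg
        rw [← proj_component x h']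
        induction component x (R.comap F) using Quotient.ind
        rfl }
  map_id a := hom_ext fun R => congrArg (Quotient.mk _) (F.map_id a.obj)
  map_comp x y := hom_ext fun R => by
    change R.qmap F ((R.comap F).qcomp (component x _) (component y _)) =
      R.qcomp (R.qmap F (component x _)) (R.qmap F (component y _))
    induction component x (R.comap F) using Quotient.ind
    induction component y (R.comap F) using Quotient.ind
    exact congrArg (Quotient.mk _) (F.map_comp _ _)

/-- The continuous extension of a functor of two variables to the profinite completions. -/
def map₂ [Finite G] [Finite H] (F : G × H ⥤ K) :
    ProCompletion G × ProCompletion H ⥤ ProCompletion K where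
  obj p := ⟨F.obj (p.1.obj, p.2.obj)⟩
  map x :=
    { component := fun R =>
        R.qmap₂ F (component x.1 (R.comapLeft F)) (component x.2 (R.comapRight F))
      proj_component := fun {R S} h => by
        have h1 : R.comapLeft F ≤ S.comapLeft F := fun a b f g hfg c => h _ _ (hfg c)
        have h2 : R.comapRight F ≤ S.comapRight F := fun a b f g hfg c => h _ _ (hfg c)
        rw [← proj_component x.1 h1, ← proj_component x.2 h2]
        induction component x.1 (R.comapLeft F) using Quotient.ind
        induction component x.2 (R.comapRight F) using Quotient.ind
        rfl }
  map_id a := hom_ext fun R => congrArg (Quotient.mk _) (F.map_id (a.1.obj, a.2.obj))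
  map_comp x y := hom_ext fun R => by
    change R.qmap₂ F ((R.comapLeft F).qcomp (component x.1 _) (component y.1 _))
        ((R.comapRight F).qcomp (component x.2 _) (component y.2 _)) =
      R.qcomp (R.qmap₂ F (component x.1 _) (component x.2 _))
        (R.qmap₂ F (component y.1 _) (component y.2 _))
    induction component x.1 (R.comapLeft F) using Quotient.ind
    induction component y.1 (R.comapLeft F) using Quotient.ind
    induction component x.2 (R.comapRight F) using Quotient.ind
    induction component y.2 (R.comapRight F) using Quotient.ind
    exact congrArg (Quotient.mk _) (F.map_comp (_ ×ₘ _) (_ ×ₘ _))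

/-- The preimage, under a homomorphism from a group to the automorphism group of an object, of the
automorphisms that become trivial in a finite quotient of the groupoid. -/
def kernel {A : Type} [Group A] {a : G} (φ : A →* End a) (R : CompatRel G) : Subgroup A where
  carrier := {w | R.rel a a (φ w) (𝟙 a)}
  one_mem' := by
    change R.rel a a (φ 1) (𝟙 a)
    rw [map_one]
    exact Setoid.refl' _ _
  mul_mem' {v w} hv hw := by
    change R.rel a a (φ (v * w)) (𝟙 a)
    rw [map_mul]
    simpa using R.comp hw hv
  inv_mem' {w} hw := by
    change R.rel a a (φ w⁻¹) (𝟙 a)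
    have h : R.rel a a (Groupoid.inv (φ w)) (Groupoid.inv (𝟙 a)) := R.inv hw
    rw [show Groupoid.inv (𝟙 a) = 𝟙 a by simp] at h
    rw [map_inv]
    exact h

theorem mem_kernel {A : Type} [Group A] {a : G} (φ : A →* End a) (R : CompatRel G) (w : A) :
    w ∈ kernel φ R ↔ R.rel a a (φ w) (𝟙 a) := Iff.rfl

theorem rel_of_inv_mul_mem {A : Type} [Group A] {a : G} (φ : A →* End a) (R : CompatRel G)
    {v w : A} : v⁻¹ * w ∈ kernel φ R ↔ R.rel a a (φ v) (φ w) := by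
  rw [mem_kernel, map_mul, map_inv]
  change R.rel a a (φ w ≫ Groupoid.inv (φ v)) (𝟙 a) ↔ _
  constructor
  · intro h
    have := R.comp_right (φ v) h
    simp only [Category.assoc, Groupoid.inv_comp, Category.comp_id, Category.id_comp] at this
    exact Setoid.symm' _ this
  · intro h
    have := R.comp_right (Groupoid.inv (φ v)) (Setoid.symm' _ h)
    rwa [Groupoid.comp_inv] at this

instance {A : Type} [Group A] {a : G} (φ : A →* End a) (R : CompatRel G) :
    (kernel φ R).Normal where
  conj_mem v hv w := by
    have h := R.comp_left (Groupoid.inv (φ w)) (R.comp_right (φ w) hv)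
    simp only [Category.id_comp, Groupoid.inv_comp] at h
    rw [mem_kernel, map_mul, map_mul, map_inv]
    exact h

/-- The map from the corresponding finite quotient of the group. -/
def kernelMap {A : Type} [Group A] {a : G} (φ : A →* End a) (R : CompatRel G) :
    A ⧸ kernel φ R → Quotient (R.rel a a) :=
  Quotient.map' φ fun _ _ h => (rel_of_inv_mul_mem φ R).1 (QuotientGroup.leftRel_apply.1 h)

theorem kernelMap_mul {A : Type} [Group A] {a : G} (φ : A →* End a) (R : CompatRel G)
    (x y : A ⧸ kernel φ R) :
    kernelMap φ R (x * y) = R.qcomp (kernelMap φ R y) (kernelMap φ R x) := by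
  induction x using QuotientGroup.induction_on
  induction y using QuotientGroup.induction_on
  exact congrArg (Quotient.mk _) (map_mul φ _ _)

instance {A : Type} [Group A] {a : G} (φ : A →* End a) (R : CompatRel G) :
    (kernel φ R).FiniteIndex := by
  have : Finite (A ⧸ kernel φ R) := Finite.of_injective (kernelMap φ R) (by
    intro x y
    induction x using QuotientGroup.induction_on
    induction y using QuotientGroup.induction_on
    intro h
    exact QuotientGroup.eq.2 ((rel_of_inv_mul_mem φ R).2 (Quotient.exact (s := R.rel a a) h)))
  exact Subgroup.finiteIndex_of_finite_quotient

/-- The continuous extension, to the profinite completion of a group, of a homomorphism to the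
automorphism group of an object of a groupoid. -/
def extend {A : Type} [Group A] {a : G} (φ : A →* End a) :
    ProfiniteGrp.ProfiniteCompletion.completion (GrpCat.of A) →* End (⟨a⟩ : ProCompletion G) where
  toFun ξ :=
    { component := fun R => kernelMap φ R (ξ.1 (FiniteIndexNormalSubgroup.ofSubgroup (kernel φ R)))
      proj_component := fun {R S} h => by
        have hle : FiniteIndexNormalSubgroup.ofSubgroup (kernel φ R) ≤
            FiniteIndexNormalSubgroup.ofSubgroup (kernel φ S) := fun w hw => h _ _ hw
        rw [← ξ.2 (homOfLE hle)]
        induction ξ.1 (FiniteIndexNormalSubgroup.ofSubgroup (kernel φ R)) using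
          QuotientGroup.induction_on
        rfl }
  map_one' := hom_ext fun R => congrArg (Quotient.mk _) (map_one φ)
  map_mul' ξ ζ := hom_ext fun R => kernelMap_mul φ R _ _

end ProCompletion

/-! ## The Grothendieck–Teichmüller group -/

/-- The groupoid of the profinite completion of the operad `PaB` in arity `n`. -/
abbrev PaBHat (n : ℕ) : Type := ProCompletion (PaB n)

/-- The action of a permutation on the completed groupoid. -/
abbrev permHat {n : ℕ} (θ : Equiv.Perm (Fin n)) : PaBHat n ⥤ PaBHat n :=
  ProCompletion.map (PaB.perm θ)

/-- The operadic insertion `∘ᵢ` on the completed groupoids. -/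
abbrev insertionHat {n m : ℕ} (i : Fin (n + 1)) : PaBHat (n + 1) × PaBHat m ⥤ PaBHat (n + m) :=
  ProCompletion.map₂ (PaB.insertion i)

/-- The profinite Grothendieck–Teichmüller group: the continuous automorphisms, identical on
objects, of the profinite completion of the operad of parenthesized braids. -/
structure GTHat where
  toHomeo : ∀ {n : ℕ} (a b : PaBHat n), (a ⟶ b) ≃ₜ (a ⟶ b)
  map_id : ∀ {n : ℕ} (a : PaBHat n), toHomeo a a (𝟙 a) = 𝟙 a
  map_comp : ∀ {n : ℕ} {a b c : PaBHat n} (x : a ⟶ b) (y : b ⟶ c),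
    toHomeo a c (x ≫ y) = toHomeo a b x ≫ toHomeo b c y
  map_perm : ∀ {n : ℕ} (θ : Equiv.Perm (Fin n)) {a b : PaBHat n} (x : a ⟶ b),
    toHomeo _ _ ((permHat θ).map x) = (permHat θ).map (toHomeo a b x)
  map_insertion : ∀ {n m : ℕ} (i : Fin (n + 1)) {a a' : PaBHat (n + 1)} {b b' : PaBHat m}
    (x : a ⟶ a') (y : b ⟶ b'),
    toHomeo _ _ ((insertionHat i).map (x ×ₘ y)) =
      (insertionHat i).map (toHomeo a a' x ×ₘ toHomeo b b' y)

/-- The object `1 2` of `PaB(2)`. -/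
def obj12 : PaB 2 := ⟨.of 0 * .of 1, by decide⟩

/-- The object `2 1` of `PaB(2)`. -/
def obj21 : PaB 2 := ⟨.of 1 * .of 0, by decide⟩

/-- The object `(1 2) 3` of `PaB(3)`. -/
def obj12_3 : PaB 3 := ⟨(.of 0 * .of 1) * .of 2, by decide⟩

/-- The object `1 (2 3)` of `PaB(3)`. -/
def obj1_23 : PaB 3 := ⟨.of 0 * (.of 1 * .of 2), by decide⟩

/-- The braiding. -/
def braiding : obj12 ⟶ obj21 := PaB.mkHom (sigma 2 0) fun i => by
  ext
  rw [braidPerm_sigma_val (by norm_num)]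
  revert i
  decide

/-- The associator: it is given by the trivial braid. -/
def associator : obj12_3 ⟶ obj1_23 := PaB.mkHom 1 fun i => by
  rw [map_one, Equiv.Perm.one_apply]
  revert i
  decide

/-- The pair `(m̂, f̂)` of an element of the Grothendieck–Teichmüller group. The component `m̂` lives
in the automorphism group of `1 2`, which is the profinite completion of `PB_2 ≅ ℤ`, and `f̂` in the
automorphism group of `(1 2) 3`, which is the profinite completion of `PB_3`. They are determined
by `T(β) = β · m̂` and `T(α) = α · f̂`. -/
def GTHat.pair (T : GTHat) :
    End (⟨obj12⟩ : PaBHat 2) × End (⟨obj12_3⟩ : PaBHat 3) :=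
  (T.toHomeo _ _ (ProCompletion.eta.map braiding) ≫ Groupoid.inv (ProCompletion.eta.map braiding),
    T.toHomeo _ _ (ProCompletion.eta.map associator) ≫
      Groupoid.inv (ProCompletion.eta.map associator))

/-- The standard generator `x₁₂ = σ₁²` of `PB_3`. -/
def x12 : PureBraid 3 := ⟨sigma 3 0 ^ 2, by
  rw [PureBraid, MonoidHom.mem_ker, map_pow, braidPerm, Braid.lift_sigma _ _ (by norm_num)]
  decide⟩

/-- The standard generator `x₂₃ = σ₂²` of `PB_3`. -/
def x23 : PureBraid 3 := ⟨sigma 3 1 ^ 2, by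
  rw [PureBraid, MonoidHom.mem_ker, map_pow, braidPerm, Braid.lift_sigma _ _ (by norm_num)]
  decide⟩

/-- The free group on two generators `x`, `y`, with the embedding `x ↦ x₁₂`, `y ↦ x₂₃` in `PB_3`. -/
def freeToPure : FreeGroup (Fin 2) →* PureBraid 3 := FreeGroup.lift ![x12, x23]

/-- The profinite completion of the free group on two generators. -/
abbrev F2Hat : ProfiniteGrp.{0} :=
  ProfiniteGrp.ProfiniteCompletion.completion (GrpCat.of (FreeGroup (Fin 2)))

/-- The continuous embedding, with `x ↦ x₁₂` and `y ↦ x₂₃`, of the profinite free group in the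
automorphism group of `(1 2) 3`, the profinite completion of `PB_3`. -/
def F2Hat.toPure : F2Hat →* End (⟨obj12_3⟩ : PaBHat 3) :=
  ProCompletion.extend ((PaB.pureEnd obj12_3).toMonoidHom.comp freeToPure)

end GTHatPaB

namespace GTHatPaB

/-! ## Linking numbers of strands -/

/-! Count, with sign, the crossings between two strands of a braid. When strands are named by their
labels, this count is additive under composition in $\mathsf{PaB}(n)$. Under an operadic insertion
it is equally simple: two inserted labels cross as in the inner braid, and every other pair of
labels crosses as in the outer braid, the inserted labels standing for the replaced one
(`linkHat_insertion_inner`, `linkHat_insertion_outer`). Modulo any positive integer the counts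
factor through a finite quotient, so they are defined on the completion and obey the same rules
there.

Apply $\hat T$ to the pentagon and read off the crossings of a well-chosen pair among the four
strands. Three of the five edges contribute the same crossing number $a$ of $\hat T(\alpha)$ and the
other two contribute zero; they are distributed over the two sides so that the equation is $a = 2a$.
Three such pairs of strands give the three crossing numbers of $\hat T(\alpha)$, so all of them
vanish modulo every positive integer (`GTHat.linkHat_associator`). The associator is a trivial
braid, so the same holds for $\hat f$.

On the other side, $\mathrm{PB}_3$ is generated by $x_{12}$, $x_{23}$ and the central full twist
$c$. Every pure braid can therefore be written $x_{12}^p x_{23}^q v c^k$ with $v$ in the image of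
$[\mathsf F_2,\mathsf F_2]$, and its crossing numbers are $2p+2k$, $2q+2k$ and $2k$. If $2N$ divides
all three, then $N$ divides $k$, $p$ and $q$. For a finite quotient whose kernel in $\mathrm{PB}_3$
has index $N$, the three powers disappear and only $v$ is left (`exists_commutator_of_pureLink`).
Hence $\hat f$ agrees in each finite quotient with an element coming from the discrete commutator
subgroup.

A compactness argument in $\widehat{\mathsf F}_2$ turns these separate approximations into a single
preimage of $\hat f$ in the closed commutator subgroup (`mem_map_extend_of_forall_component`). Since
all computations take place in finite quotients, injectivity of $\widehat{\mathsf
F}_2\to\widehat{\mathrm{PB}}_3$ is not needed. -/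

/-- The number of crossings (`0` or `1`) in the generator with index `j` between the strands that
start in the positions `p` and `q`. -/
def crossing (j p q : ℕ) : ℤ := if (p = j ∧ q = j + 1) ∨ (p = j + 1 ∧ q = j) then 1 else 0

/-- The action of the generator with index `j` on triples consisting of two positions and the
number of crossings counted so far. -/
def crossingPerm (n j : ℕ) : Equiv.Perm ((Fin n × Fin n) × ℤ) where
  toFun p := ((adjSwap n j p.1.1, adjSwap n j p.1.2), crossing j p.1.1 p.1.2 + p.2)
  invFun p := (((adjSwap n j)⁻¹ p.1.1, (adjSwap n j)⁻¹ p.1.2),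
    -crossing j ((adjSwap n j)⁻¹ p.1.1 : Fin n) ((adjSwap n j)⁻¹ p.1.2 : Fin n) + p.2)
  left_inv p := by simp
  right_inv p := by simp

/-- Two distant generators cross disjoint pairs of positions, so their order does not affect any
count. In the braid relation, each two of the three strands involved cross exactly once on either
side. -/
theorem crossingPerm_isBraiding (n : ℕ) : IsBraiding (crossingPerm n) (n - 1) where
  far i j hij hj := by
    refine Equiv.ext fun ⟨⟨p, q⟩, z⟩ => Prod.ext (Prod.ext ?_ ?_) ?_
    · exact congrArg (fun e => e p) ((adjSwap_isBraiding n).far i j hij hj)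
    · exact congrArg (fun e => e q) ((adjSwap_isBraiding n).far i j hij hj)
    · simp only [Equiv.Perm.mul_apply, crossingPerm, Equiv.coe_fn_mk,
        adjSwap_val (show i + 1 < n by omega), adjSwap_val (show j + 1 < n by omega), ← add_assoc]
      congr 1
      unfold crossing
      grind
  near i hi := by
    refine Equiv.ext fun ⟨⟨p, q⟩, z⟩ => Prod.ext (Prod.ext ?_ ?_) ?_
    · exact congrArg (fun e => e p) ((adjSwap_isBraiding n).near i hi)
    · exact congrArg (fun e => e q) ((adjSwap_isBraiding n).near i hi)
    · simp only [Equiv.Perm.mul_apply, crossingPerm, Equiv.coe_fn_mk,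
        adjSwap_val (show i + 1 < n by omega), adjSwap_val (show i + 1 + 1 < n by omega),
        ← add_assoc]
      congr 1
      unfold crossing
      generalize (p : ℕ) = a
      generalize (q : ℕ) = b
      -- Each of the two positions is one of the three moved by the relation or is left alone, which
      -- gives sixteen cases.
      have split : ∀ c : ℕ, c = i ∨ c = i + 1 ∨ c = i + 1 + 1 ∨
          c ≠ i ∧ c ≠ i + 1 ∧ c ≠ i + 1 + 1 := fun c => by omega
      have e1 : ¬ i + 1 + 1 = i := by omega
      have e2 : ¬ i = i + 1 + 1 := by omega
      rcases split a with h | h | h | h <;> rcases split b with h' | h' | h' | h' <;>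
        simp [h, h', e1, e2]

/-- The signed number of crossings, in the braid `g`, between the strands that start in the
positions `p` and `q`. -/
def link (n : ℕ) (g : Braid n) (p q : Fin n) : ℤ :=
  (Braid.lift (crossingPerm n) (crossingPerm_isBraiding n) g ((p, q), 0)).2

/-- The action only translates the counter, so its value at counter `0`, which defines `link`,
determines it everywhere. This is what produces the cocycle rule `link_mul`. -/
theorem lift_crossingPerm (n : ℕ) (g : Braid n) : ∀ (p q : Fin n) (z : ℤ),
    Braid.lift (crossingPerm n) (crossingPerm_isBraiding n) g ((p, q), z) =
      ((braidPerm n g p, braidPerm n g q), link n g p q + z) := by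
  induction g using Braid.induction with
  | one => intro p q z; simp [link]
  | gen j hj =>
    intro p q z
    rw [link, braidPerm, Braid.lift_sigma _ _ hj, Braid.lift_sigma _ _ hj]
    simp [crossingPerm]
  | mul g h hg hh =>
    intro p q z
    -- The summand `0` is the initial counter in the definition of `link`.
    have e : link n (g * h) p q =
        link n g (braidPerm n h p) (braidPerm n h q) + (link n h p q + 0) := by
      conv_lhs => rw [link, map_mul, Equiv.Perm.mul_apply, hh, hg]
    rw [e, map_mul, Equiv.Perm.mul_apply, hh, hg, map_mul, Equiv.Perm.mul_apply,
      Equiv.Perm.mul_apply, add_zero, add_assoc]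
  | inv g hg =>
    intro p q z
    have key : ∀ z', (Braid.lift (crossingPerm n) (crossingPerm_isBraiding n) g)⁻¹ ((p, q), z') =
        (((braidPerm n g)⁻¹ p, (braidPerm n g)⁻¹ q),
          -link n g ((braidPerm n g)⁻¹ p) ((braidPerm n g)⁻¹ q) + z') := by
      intro z'
      rw [Equiv.Perm.inv_eq_iff_eq, hg]
      simp
    have e : link n g⁻¹ p q = -link n g ((braidPerm n g)⁻¹ p) ((braidPerm n g)⁻¹ q) + 0 := by
      conv_lhs => rw [link, map_inv, key]
    rw [e, map_inv, key, map_inv, add_zero]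

@[simp] theorem link_one (n : ℕ) (p q : Fin n) : link n 1 p q = 0 := by
  simp [link]

/-- Products are read from right to left: `h` acts first and carries the two strands to the
positions from which `g` takes over. -/
theorem link_mul (n : ℕ) (g h : Braid n) (p q : Fin n) :
    link n (g * h) p q = link n g (braidPerm n h p) (braidPerm n h q) + link n h p q := by
  conv_lhs => rw [link, map_mul, Equiv.Perm.mul_apply, lift_crossingPerm n h,
    lift_crossingPerm n g]
  simp

theorem link_inv (n : ℕ) (g : Braid n) (p q : Fin n) :
    link n g⁻¹ p q = -link n g (braidPerm n g⁻¹ p) (braidPerm n g⁻¹ q) := by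
  have := link_mul n g g⁻¹ p q
  rw [mul_inv_cancel, link_one] at this
  omega

theorem link_sigma {n j : ℕ} (hj : j + 1 < n) (p q : Fin n) :
    link n (sigma n j) p q = crossing j p q := by
  rw [link, Braid.lift_sigma _ _ (by omega)]
  simp [crossingPerm]

/-- A strand does not cross itself. This makes the outer braid invisible for two labels inserted at
the same place. -/
theorem link_self (n : ℕ) (g : Braid n) : ∀ p, link n g p p = 0 := by
  induction g using Braid.induction with
  | one => simp
  | gen j hj => intro p; rw [link_sigma (by omega), crossing, if_neg (by omega)]
  | mul g h hg hh => intro p; rw [link_mul, hg, hh, add_zero]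
  | inv g hg => intro p; rw [link_inv, hg, neg_zero]

/-! ### Linking numbers of cabled and inserted braids -/

/-- The strand, before cabling, that gives rise to the strand in position `q` after the strand in
position `k` has been replaced by `m` parallel strands. -/
def collapse (m k q : ℕ) : ℕ := if q < k then q else if q < k + m then k else q + 1 - m

/-- The strand from position `j + m` meets each of the `m` parallel strands once, and these do not
meet each other. In the induction the rightmost generator performs the crossing with the last strand
of the block, and the remaining factors perform the others. -/
theorem blockOver_link {N j : ℕ} (m : ℕ) (h : j + m < N) (p q : Fin N) :
    link N (blockOver (sigma N) j m) p q =
      if ((p : ℕ) = j + m ∧ j ≤ q ∧ (q : ℕ) < j + m) ∨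
        ((q : ℕ) = j + m ∧ j ≤ p ∧ (p : ℕ) < j + m) then 1 else 0 := by
  induction m generalizing p q with
  | zero =>
    rw [if_neg (by omega)]
    simp [blockOver]
  | succ m ih =>
    rw [blockOver, link_mul, ih (by omega), link_sigma (by omega), crossing,
      braidPerm_sigma_val (by omega), braidPerm_sigma_val (by omega)]
    grind

/-- The mirror image of `blockOver_link`. Here the long factor acts first, so its permutation is
needed to see which strands the last generator crosses. -/
theorem blockUnder_link {N j : ℕ} (m : ℕ) (h : j + m < N) (p q : Fin N) :
    link N (blockUnder (sigma N) j m) p q =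
      if ((p : ℕ) = j ∧ j < q ∧ (q : ℕ) ≤ j + m) ∨
        ((q : ℕ) = j ∧ j < p ∧ (p : ℕ) ≤ j + m) then 1 else 0 := by
  induction m with
  | zero =>
    rw [if_neg (by omega)]
    simp [blockUnder]
  | succ m ih =>
    rw [blockUnder, link_mul, ih (by omega), link_sigma (by omega), crossing,
      blockUnder_perm _ (by omega), blockUnder_perm _ (by omega)]
    grind

/-- Following a strand of the cabled braid and then forgetting the cabling is the same as following
the strand of `g` that it comes from. The cabled position moves along with `g`. -/
theorem collapse_cable_perm (n m : ℕ) (g : Braid (n + 1)) (k p : Fin (n + 1)) (q : Fin (n + m))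
    (h : (p : ℕ) = collapse m k q) :
    collapse m (braidPerm (n + 1) g k : Fin (n + 1))
      (braidPerm (n + m) (cable n m g k) q : Fin (n + m)) =
      (braidPerm (n + 1) g p : Fin (n + 1)) := by
  by_cases hpk : p = k
  · subst hpk
    -- `collapse` takes the value of the cabled position exactly on the block of `m` parallel
    -- strands.
    have h1 : (p : ℕ) ≤ q ∧ (q : ℕ) < p + m := by
      unfold collapse at h
      split_ifs at h <;> omega
    have := cable_perm_of_eq n m g p (q - p) q (by omega) (by omega)
    rw [this, collapse]
    split_ifs <;> omega
  · have hne : (p : ℕ) ≠ k := fun e => hpk (Fin.ext e)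
    have hne' :
        ((braidPerm (n + 1) g p : Fin (n + 1)) : ℕ) ≠ (braidPerm (n + 1) g k : Fin (n + 1)) :=
      fun e => hpk ((braidPerm (n + 1) g).injective (Fin.ext e))
    -- Away from the block, `collapse` and `shiftPos` are inverse to each other.
    have hq : (q : ℕ) = shiftPos m k p := by
      unfold collapse at h
      unfold shiftPos
      split_ifs at h ⊢ <;> omega
    rw [cable_perm_of_ne n m g k p q hpk hq]
    unfold collapse shiftPos
    split_ifs <;> omega

/-- A crossing of `g` with the cabled strand becomes one crossing of the same sign with each
parallel strand, and strands within the cable never cross. The cabled position is universally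
quantified because it changes from one factor of a product to the next. -/
theorem link_cable (n m : ℕ) (g : Braid (n + 1)) :
    ∀ (k p p' : Fin (n + 1)) (q q' : Fin (n + m)), (p : ℕ) = collapse m k q →
      (p' : ℕ) = collapse m k q' →
      link (n + m) (cable n m g k) q q' = link (n + 1) g p p' := by
  induction g using Braid.induction with
  | one => intro k p p' q q' _ _; simp [cable_one]
  | gen j hj =>
    intro k p p' q q' h h'
    rw [cable_sigma n m (by omega), link_sigma (by omega), cabledSigma, crossing, h, h']
    have hq := q.2
    have hq' := q'.2
    unfold collapse
    rcases Nat.lt_trichotomy k j with h1 | h1 | h1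
    · rw [if_pos h1, link_sigma (by omega), crossing]
      congr 1
      grind
    · rw [if_neg (by omega), if_pos h1, blockOver_link _ (by omega)]
      congr 1
      grind
    · rcases Nat.lt_trichotomy k (j + 1) with h2 | h2 | h2
      · omega
      · rw [if_neg (by omega), if_neg (by omega), if_pos h2, blockUnder_link _ (by omega)]
        congr 1
        grind
      · rw [if_neg (by omega), if_neg (by omega), if_neg (by omega), link_sigma (by omega),
          crossing]
        congr 1
        grind
  | mul g h hg hh =>
    intro k p p' q q' e e'
    rw [cable_mul, link_mul, link_mul, hh k p p' q q' e e']
    rw [hg _ _ _ _ _ (collapse_cable_perm n m h k p q e).symm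
      (collapse_cable_perm n m h k p' q' e').symm]
  | inv g hg =>
    intro k p p' q q' e e'
    have := collapse_cable_perm n m g⁻¹ k p q e
    have h' := collapse_cable_perm n m g⁻¹ k p' q' e'
    rw [link_inv, ← hg _ _ _ _ _ this.symm h'.symm, cable_inv, link_inv, ← cable_inv]

theorem link_insertBraid_of_mem (n m : ℕ) (k : Fin (n + 1)) (d : Braid m) :
    ∀ (t t' : Fin m) (q q' : Fin (n + m)), (q : ℕ) = k + t → (q' : ℕ) = k + t' →
      link (n + m) (insertBraid n m k d) q q' = link m d t t' := by
  induction d using Braid.induction with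
  | one => intro t t' q q' h h'; simp
  | gen j hj =>
    intro t t' q q' h h'
    rw [insertBraid_sigma _ _ _ hj, link_sigma (by omega), link_sigma (by omega), crossing,
      crossing]
    congr 1
    grind
  | mul d e hd he =>
    intro t t' q q' h h'
    rw [map_mul, link_mul, link_mul, he t t' q q' h h']
    rw [hd _ _ _ _ (insertBraid_perm_of_mem n m k e _ _ h)
      (insertBraid_perm_of_mem n m k e _ _ h')]
  | inv d hd =>
    intro t t' q q' h h'
    rw [map_inv, link_inv, link_inv]
    rw [← map_inv, hd _ _ _ _ (insertBraid_perm_of_mem n m k d⁻¹ _ _ h)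
      (insertBraid_perm_of_mem n m k d⁻¹ _ _ h')]

/-- A strand outside the block is fixed by every generator of the inserted braid, hence stays
outside and crosses nothing. -/
theorem link_insertBraid_of_notMem (n m : ℕ) (k : Fin (n + 1)) (d : Braid m) (q q' : Fin (n + m))
    (h : ((q : ℕ) < k ∨ (k : ℕ) + m ≤ q) ∨ ((q' : ℕ) < k ∨ (k : ℕ) + m ≤ q')) :
    link (n + m) (insertBraid n m k d) q q' = 0 := by
  have hmem : ∀ (d : Braid m) (q : Fin (n + m)), ((q : ℕ) < k ∨ (k : ℕ) + m ≤ q) →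
      (((braidPerm (n + m) (insertBraid n m k d) q : Fin (n + m)) : ℕ) < k ∨
        (k : ℕ) + m ≤ (braidPerm (n + m) (insertBraid n m k d) q : Fin (n + m))) := by
    intro d q h
    rwa [insertBraid_perm_of_notMem n m k d q h]
  induction d using Braid.induction generalizing q q' with
  | one => simp
  | gen j hj =>
    rw [insertBraid_sigma _ _ _ hj, link_sigma (by omega), crossing, if_neg (by omega)]
  | mul d e hd he =>
    rw [map_mul, link_mul, he q q' h, add_zero]
    exact hd _ _ (h.imp (hmem e q) (hmem e q'))
  | inv d hd =>
    rw [map_inv, link_inv, ← map_inv, hd _ _ (h.imp (hmem d⁻¹ q) (hmem d⁻¹ q')), neg_zero]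

/-! ### Linking numbers of morphisms of parenthesized braids -/

namespace PaB

variable {n : ℕ}

/-- The signed number of crossings between the strands with the labels `i` and `j`. -/
def linking {a b : PaB n} (f : a ⟶ b) (i j : Fin n) : ℤ := link n (ou f) (a.pos i) (a.pos j)

@[simp] theorem linking_id (a : PaB n) (i j : Fin n) : linking (𝟙 a) i j = 0 := by
  simp [linking]

/-- A morphism carries the position of a label to the position of the same label, so naming strands
by labels removes the twist from the cocycle rule `link_mul` and leaves plain additivity. -/
theorem linking_comp {a b c : PaB n} (f : a ⟶ b) (g : b ⟶ c) (i j : Fin n) :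
    linking (f ≫ g) i j = linking f i j + linking g i j := by
  rw [linking, ou_comp, link_mul, ou_perm, ou_perm, add_comm]
  rfl

theorem linking_self {a b : PaB n} (f : a ⟶ b) (i : Fin n) : linking f i i = 0 :=
  link_self _ _ _

/-- The positions in an insertion collapse to the positions in the outer word. -/
theorem collapse_pos_insertObj {m : ℕ} (i : Fin (n + 1)) (a : PaB (n + 1)) (b : PaB m)
    (u : Fin (n + m)) (p : Fin (n + 1)) (h : (p : ℕ) = collapse m i u) :
    (a.pos p : ℕ) = collapse m (a.pos i) ((insertObj i a b).pos u) := by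
  rcases label_cases i u with ⟨l, hl, rfl⟩ | ⟨t, rfl⟩
  · have hne : (a.pos l : ℕ) ≠ a.pos i := fun e => hl (a.pos_injective (Fin.ext e))
    have hli : (l : ℕ) ≠ i := fun e => hl (Fin.ext e)
    have hpl : p = l := by
      ext
      rw [h]
      simp only [outer, collapse, shiftPos]
      split_ifs <;> omega
    rw [pos_insertObj_outer, hpl]
    unfold collapse shiftPos
    split_ifs <;> omega
  · have hpi : p = i := by
      ext
      rw [h, collapse, inner, if_neg (by simp), if_pos (by simp)]
    rw [pos_insertObj_inner, hpi]
    unfold collapse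
    split_ifs <;> omega

/-- The linking numbers in an insertion are those of the outer braid, where the inserted strands
count as the replaced one, plus those of the inserted braid. -/
theorem linking_insertion {m : ℕ} (i : Fin (n + 1)) {p q : PaB (n + 1) × PaB m} (f : p ⟶ q)
    (u v : Fin (n + m)) (l l' : Fin (n + 1)) (hl : (l : ℕ) = collapse m i u)
    (hl' : (l' : ℕ) = collapse m i v) :
    linking ((insertion i).map f) u v = linking f.1 l l' +
      link (n + m) (insertBraid n m (p.1.pos i) (ou f.2)) ((insertObj i p.1 p.2).pos u)
        ((insertObj i p.1 p.2).pos v) := by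
  -- The inserted braid acts before the cabled one. It permutes the block and fixes all other
  -- positions, so it does not change the strand of the outer braid to which a position belongs.
  have key : ∀ (u : Fin (n + m)) (l : Fin (n + 1)), (l : ℕ) = collapse m i u →
      (p.1.pos l : ℕ) = collapse m (p.1.pos i) (braidPerm (n + m)
        (insertBraid n m (p.1.pos i) (ou f.2)) ((insertObj i p.1 p.2).pos u) : Fin (n + m)) := by
    intro u l hl
    have h1 := collapse_pos_insertObj i p.1 p.2 u l hl
    by_cases hu : (((insertObj i p.1 p.2).pos u : ℕ) < p.1.pos i) ∨
        (p.1.pos i : ℕ) + m ≤ (insertObj i p.1 p.2).pos u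
    · rw [insertBraid_perm_of_notMem n m _ _ _ hu, h1]
    · have h2 := insertBraid_perm_of_mem n m (p.1.pos i) (ou f.2)
        ⟨(insertObj i p.1 p.2).pos u - p.1.pos i, by omega⟩ ((insertObj i p.1 p.2).pos u)
        (by simp only; omega)
      rw [h1, h2]
      unfold collapse
      split_ifs <;> omega
  change link (n + m) (cable n m (ou f.1) (p.1.pos i) *
    insertBraid n m (p.1.pos i) (ou f.2)) ((insertObj i p.1 p.2).pos u)
      ((insertObj i p.1 p.2).pos v) = _
  rw [link_mul, link_cable n m _ _ _ _ _ _ (key u l hl) (key v l' hl')]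
  rfl

/-- If one of the two labels lies outside the inserted block, the inserted braid contributes no
crossing. -/
theorem linking_insertion_outer {m : ℕ} (i : Fin (n + 1)) {p q : PaB (n + 1) × PaB m} (f : p ⟶ q)
    (u v : Fin (n + m)) (l l' : Fin (n + 1)) (hl : (l : ℕ) = collapse m i u)
    (hl' : (l' : ℕ) = collapse m i v) (h : l ≠ i ∨ l' ≠ i) :
    linking ((insertion i).map f) u v = linking f.1 l l' := by
  have key : ∀ (u : Fin (n + m)) (l : Fin (n + 1)), (l : ℕ) = collapse m i u → l ≠ i →
      (((insertObj i p.1 p.2).pos u : ℕ) < p.1.pos i) ∨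
        (p.1.pos i : ℕ) + m ≤ (insertObj i p.1 p.2).pos u := by
    intro u l hl hli
    have h1 := collapse_pos_insertObj i p.1 p.2 u l hl
    have hne : (p.1.pos l : ℕ) ≠ p.1.pos i := fun e => hli (p.1.pos_injective (Fin.ext e))
    unfold collapse at h1
    split_ifs at h1 <;> omega
  rw [linking_insertion i f u v l l' hl hl', link_insertBraid_of_notMem _ _ _ _ _ _
    (h.imp (key u l hl) (key v l' hl')), add_zero]

/-- Both labels run inside the same strand of the outer braid, which contributes its crossing number
with itself, namely zero. -/
theorem linking_insertion_inner {m : ℕ} (i : Fin (n + 1)) {p q : PaB (n + 1) × PaB m} (f : p ⟶ q)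
    (u v : Fin (n + m)) (t t' : Fin m) (h : (u : ℕ) = i + t) (h' : (v : ℕ) = i + t') :
    linking ((insertion i).map f) u v = linking f.2 t t' := by
  obtain rfl : u = inner i t := Fin.ext h
  obtain rfl : v = inner i t' := Fin.ext h'
  have hc : ∀ t : Fin m, (i : ℕ) = collapse m i (inner i t) := fun t => by
    rw [collapse, inner, if_neg (by simp), if_pos (by simp)]
  rw [linking_insertion i f _ _ i i (hc t) (hc t'), linking_self, zero_add,
    link_insertBraid_of_mem n m _ _ _ _ _ _ (pos_insertObj_inner i p.1 p.2 t)
      (pos_insertObj_inner i p.1 p.2 t')]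
  rfl

end PaB

/-! ### Linking numbers in the profinite completion -/

namespace CompatRel

variable {G : Type} [Groupoid.{0} G]

/-- The common refinement of two compatible equivalence relations. -/
instance : Min (CompatRel G) where
  min R S :=
    { rel := fun a b => R.rel a b ⊓ S.rel a b
      comp_left := fun h _ _ hfg => ⟨R.comp_left h hfg.1, S.comp_left h hfg.2⟩
      comp_right := fun h hfg => ⟨R.comp_right h hfg.1, S.comp_right h hfg.2⟩
      finite := by
        have := R.finite
        have := S.finite
        -- A class for the intersection is determined by its classes for the two relations.
        refine Finite.of_injective
          (β := (Σ p : G × G, Quotient (R.rel p.1 p.2)) × Σ p : G × G, Quotient (S.rel p.1 p.2))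
          (fun x => (⟨x.1, Quotient.map (sb := R.rel x.1.1 x.1.2) id (fun _ _ h => And.left h) x.2⟩,
            ⟨x.1, Quotient.map (sb := S.rel x.1.1 x.1.2) id (fun _ _ h => And.right h) x.2⟩)) ?_
        rintro ⟨p, ⟨f⟩⟩ ⟨p', ⟨g⟩⟩ h
        rw [Prod.mk.injEq] at h
        obtain rfl : p = p' := congrArg Sigma.fst h.1
        have h1 := eq_of_heq (Sigma.mk.inj h.1).2
        have h2 := eq_of_heq (Sigma.mk.inj h.2).2
        exact congrArg (Sigma.mk p) (Quotient.sound (s := R.rel _ _ ⊓ S.rel _ _)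
          ⟨Quotient.exact (s := R.rel _ _) h1, Quotient.exact (s := S.rel _ _) h2⟩) }

theorem min_le_left (R S : CompatRel G) : R ⊓ S ≤ R := fun _ _ _ _ h => h.1

theorem min_le_right (R S : CompatRel G) : R ⊓ S ≤ S := fun _ _ _ _ h => h.2

end CompatRel

namespace ProCompletion

/-- With common refinements, this allows a single representative to serve several finite quotients
at once. -/
theorem component_eq_of_le {G : Type} [Groupoid.{0} G] {a b : ProCompletion G} {x : a ⟶ b}
    {R S : CompatRel G} (h : R ≤ S) {f : a.obj ⟶ b.obj} (hf : component x R = ⟦f⟧) :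
    component x S = ⟦f⟧ := by
  rw [← proj_component x h, hf]
  rfl

end ProCompletion

open ProCompletion

/-- Morphisms of `PaB(n)` are identified if their linking numbers agree modulo `N`. -/
def linkRel (n N : ℕ) [NeZero N] : CompatRel (PaB n) where
  rel a b := Setoid.ker fun (f : a ⟶ b) (i j : Fin n) => (PaB.linking f i j : ZMod N)
  comp_left h f g hfg := by
    simp only [Setoid.ker_def, PaB.linking_comp, Int.cast_add, funext_iff] at hfg ⊢
    simp [hfg]
  comp_right h hfg := by
    simp only [Setoid.ker_def, PaB.linking_comp, Int.cast_add, funext_iff] at hfg ⊢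
    simp [hfg]
  finite := by
    -- The classes of morphisms embed in the finite set of matrices over `ZMod N`.
    have : ∀ p : PaB n × PaB n, Finite (Quotient (Setoid.ker fun (f : p.1 ⟶ p.2) (i j : Fin n) =>
        (PaB.linking f i j : ZMod N))) := fun p =>
      Finite.of_injective _ (Setoid.kerLift_injective
        fun (f : p.1 ⟶ p.2) (i j : Fin n) => (PaB.linking f i j : ZMod N))
    infer_instance

/-- The linking numbers modulo `N` of a morphism of the profinite completion. -/
def linkHat {n : ℕ} (N : ℕ) [NeZero N] {a b : PaBHat n} (x : a ⟶ b) : Fin n → Fin n → ZMod N :=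
  Setoid.kerLift (fun (f : a.obj ⟶ b.obj) (i j : Fin n) => (PaB.linking f i j : ZMod N))
    (component x (linkRel n N))

section

variable {n N : ℕ} [NeZero N]

theorem linkHat_of_component {a b : PaBHat n} {x : a ⟶ b} {f : a.obj ⟶ b.obj}
    (h : component x (linkRel n N) = ⟦f⟧) (i j : Fin n) :
    linkHat N x i j = PaB.linking f i j := by
  rw [linkHat, h]
  rfl

theorem linkHat_eta {a b : PaB n} (f : a ⟶ b) (i j : Fin n) :
    linkHat N (eta.map f) i j = PaB.linking f i j := rfl

@[simp] theorem linkHat_id (a : PaBHat n) (i j : Fin n) : linkHat N (𝟙 a) i j = 0 := by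
  rw [linkHat_of_component (component_id a _), PaB.linking_id, Int.cast_zero]

theorem linkHat_comp {a b c : PaBHat n} (x : a ⟶ b) (y : b ⟶ c) (i j : Fin n) :
    linkHat N (x ≫ y) i j = linkHat N x i j + linkHat N y i j := by
  obtain ⟨f, hf⟩ := Quotient.exists_rep (component x (linkRel n N))
  obtain ⟨g, hg⟩ := Quotient.exists_rep (component y (linkRel n N))
  have h : component (x ≫ y) (linkRel n N) = ⟦f ≫ g⟧ := by
    rw [component_comp, ← hf, ← hg]
    rfl
  rw [linkHat_of_component h, linkHat_of_component hf.symm, linkHat_of_component hg.symm,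
    PaB.linking_comp, Int.cast_add]

theorem linkHat_inv {a b : PaBHat n} (x : a ⟶ b) (i j : Fin n) :
    linkHat N (Groupoid.inv x) i j = -linkHat N x i j := by
  have h := linkHat_comp (N := N) x (Groupoid.inv x) i j
  rw [Groupoid.comp_inv, linkHat_id] at h
  exact (neg_eq_of_add_eq_zero_right h.symm).symm

/-- The linking numbers of an insertion are those of a representative. -/
theorem exists_linkHat_insertion {m : ℕ} (i : Fin (n + 1)) {a a' : PaBHat (n + 1)}
    {b b' : PaBHat m} (x : a ⟶ a') (y : b ⟶ b') :
    ∃ (f : a.obj ⟶ a'.obj) (g : b.obj ⟶ b'.obj),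
      (∀ l l', linkHat N x l l' = PaB.linking f l l') ∧
      (∀ l l', linkHat N y l l' = PaB.linking g l l') ∧
      ∀ u v, linkHat N ((insertionHat i).map (x ×ₘ y)) u v =
        PaB.linking ((PaB.insertion i).map (f ×ₘ g)) u v := by
  -- The representative is taken in a common refinement: the first relation controls the class of
  -- the insertion, the second the crossing numbers of `x` itself. The same is done for `y` below.
  obtain ⟨f, hf⟩ := Quotient.exists_rep
    (component x ((linkRel (n + m) N).comapLeft (PaB.insertion i) ⊓ linkRel (n + 1) N))
  obtain ⟨g, hg⟩ := Quotient.exists_rep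
    (component y ((linkRel (n + m) N).comapRight (PaB.insertion i) ⊓ linkRel m N))
  refine ⟨f, g,
    linkHat_of_component (component_eq_of_le (CompatRel.min_le_right _ _) hf.symm),
    linkHat_of_component (component_eq_of_le (CompatRel.min_le_right _ _) hg.symm),
    linkHat_of_component ?_⟩
  have h1 := component_eq_of_le (CompatRel.min_le_left _ _) hf.symm
  have h2 := component_eq_of_le (CompatRel.min_le_left _ _) hg.symm
  change CompatRel.qmap₂ _ _ (component x _) (component y _) = _
  rw [h1, h2]
  rfl

theorem linkHat_insertion_outer {m : ℕ} (i : Fin (n + 1)) {a a' : PaBHat (n + 1)}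
    {b b' : PaBHat m} (x : a ⟶ a') (y : b ⟶ b')
    (u v : Fin (n + m)) (l l' : Fin (n + 1)) (hl : (l : ℕ) = collapse m i u)
    (hl' : (l' : ℕ) = collapse m i v) (h : l ≠ i ∨ l' ≠ i) :
    linkHat N ((insertionHat i).map (x ×ₘ y)) u v = linkHat N x l l' := by
  obtain ⟨f, g, hf, -, hfg⟩ := exists_linkHat_insertion (N := N) i x y
  rw [hfg, hf, PaB.linking_insertion_outer i _ u v l l' hl hl' h]

theorem linkHat_insertion_inner {m : ℕ} (i : Fin (n + 1)) {a a' : PaBHat (n + 1)}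
    {b b' : PaBHat m} (x : a ⟶ a') (y : b ⟶ b')
    (u v : Fin (n + m)) (t t' : Fin m) (h : (u : ℕ) = i + t) (h' : (v : ℕ) = i + t') :
    linkHat N ((insertionHat i).map (x ×ₘ y)) u v = linkHat N y t t' := by
  obtain ⟨f, g, -, hg, hfg⟩ := exists_linkHat_insertion (N := N) i x y
  rw [hfg, hg, PaB.linking_insertion_inner i _ u v t t' h h']

end

/-! ## The pentagon -/

/-- The pentagon equation, for the two paths from `((1 2) 3) 4` to `1 (2 (3 4))`. -/
theorem pentagon :
    ((insertionHat (n := 2) (m := 2) 0).map (eta.map associator ×ₘ 𝟙 (⟨obj12⟩ : PaBHat 2)) ≫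
      (insertionHat (n := 2) (m := 2) 2).map (eta.map associator ×ₘ 𝟙 (⟨obj12⟩ : PaBHat 2)) :
      _ ⟶ (⟨PaB.insertObj (n := 1) 1 obj12 obj1_23⟩ : PaBHat 4)) =
    (insertionHat (n := 1) (m := 3) 0).map (𝟙 (⟨obj12⟩ : PaBHat 2) ×ₘ eta.map associator) ≫
      (insertionHat (n := 2) (m := 2) 1).map (eta.map associator ×ₘ 𝟙 (⟨obj12⟩ : PaBHat 2)) ≫
      (insertionHat (n := 1) (m := 3) 1).map (𝟙 (⟨obj12⟩ : PaBHat 2) ×ₘ eta.map associator) := by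
  -- All five edges have the trivial underlying braid, and a morphism between given objects is
  -- determined by its braid.
  have key : ∀ {a b c d e : PaB 4} (e₁ : a ⟶ b) (e₂ : b ⟶ c) (e₃ : a ⟶ d) (e₄ : d ⟶ e)
      (e₅ : e ⟶ c), PaB.ou e₁ = 1 → PaB.ou e₂ = 1 → PaB.ou e₃ = 1 → PaB.ou e₄ = 1 →
      PaB.ou e₅ = 1 → eta.map e₁ ≫ eta.map e₂ = eta.map e₃ ≫ eta.map e₄ ≫ eta.map e₅ := by
    intro a b c d e e₁ e₂ e₃ e₄ e₅ h₁ h₂ h₃ h₄ h₅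
    simp only [← Functor.map_comp]
    exact congrArg eta.map (PaB.hom_ext (by simp [h₁, h₂, h₃, h₄, h₅]))
  have trivial : ∀ {n m : ℕ} (i : Fin (n + 1)) {p q : PaB (n + 1) × PaB m} (f : p ⟶ q),
      PaB.ou f.1 = 1 → PaB.ou f.2 = 1 → PaB.ou ((PaB.insertion i).map f) = 1 := by
    intro n m i p q f h h'
    simp [PaB.insertion, h, h', cable_one]
  -- The edges run ((1 2) 3) 4 → (1 2)(3 4) → 1 (2 (3 4)) and ((1 2) 3) 4 → (1 (2 3)) 4 → 1 ((2 3)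
  -- 4) → 1 (2 (3 4)). Consecutive endpoints agree by evaluation of the words.
  exact key ((PaB.insertion (n := 2) (m := 2) 0).map (associator ×ₘ 𝟙 obj12))
    ((PaB.insertion (n := 2) (m := 2) 2).map (associator ×ₘ 𝟙 obj12))
    ((PaB.insertion (n := 1) (m := 3) 0).map (𝟙 obj12 ×ₘ associator))
    ((PaB.insertion (n := 2) (m := 2) 1).map (associator ×ₘ 𝟙 obj12))
    ((PaB.insertion (n := 1) (m := 3) 1).map (𝟙 obj12 ×ₘ associator))
    (trivial _ _ rfl rfl) (trivial _ _ rfl rfl) (trivial _ _ rfl rfl) (trivial _ _ rfl rfl)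
    (trivial _ _ rfl rfl)

/-! ### Crossing numbers of the image of the associator -/

namespace GTHat

variable (T : GTHat) {N : ℕ} [NeZero N]

/-- An automorphism of the operad commutes with insertion and fixes the inserted identity. Two
labels of the inserted block therefore see only an identity, and any other pair sees the image of
`x`. -/
theorem linkHat_insertion_left {n m : ℕ} (i : Fin (n + 1)) {a a' : PaBHat (n + 1)}
    (b : PaBHat m) (x : a ⟶ a') (u v : Fin (n + m)) (l l' : Fin (n + 1))
    (hl : (l : ℕ) = collapse m i u) (hl' : (l' : ℕ) = collapse m i v) :
    linkHat N (T.toHomeo _ _ ((insertionHat i).map (x ×ₘ 𝟙 b))) u v =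
      if l = i ∧ l' = i then 0 else linkHat N (T.toHomeo _ _ x) l l' := by
  rw [T.map_insertion, T.map_id]
  split_ifs with h
  · have hu : (i : ℕ) ≤ u ∧ (u : ℕ) < i + m := by
      rw [h.1] at hl
      unfold collapse at hl
      split_ifs at hl <;> omega
    have hv : (i : ℕ) ≤ v ∧ (v : ℕ) < i + m := by
      rw [h.2] at hl'
      unfold collapse at hl'
      split_ifs at hl' <;> omega
    rw [linkHat_insertion_inner i _ _ u v ⟨u - i, by omega⟩ ⟨v - i, by omega⟩
      (by simp only; omega) (by simp only; omega), linkHat_id]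
  · exact linkHat_insertion_outer i _ _ u v l l' hl hl' (by tauto)

theorem linkHat_insertion_right_outer {n m : ℕ} (i : Fin (n + 1)) (a : PaBHat (n + 1))
    {b b' : PaBHat m} (y : b ⟶ b') (u v : Fin (n + m)) (l l' : Fin (n + 1))
    (hl : (l : ℕ) = collapse m i u) (hl' : (l' : ℕ) = collapse m i v) (h : l ≠ i ∨ l' ≠ i) :
    linkHat N (T.toHomeo _ _ ((insertionHat i).map (𝟙 a ×ₘ y))) u v = 0 := by
  rw [T.map_insertion, T.map_id, linkHat_insertion_outer i _ _ u v l l' hl hl' h, linkHat_id]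

theorem linkHat_insertion_right_inner {n m : ℕ} (i : Fin (n + 1)) (a : PaBHat (n + 1))
    {b b' : PaBHat m} (y : b ⟶ b') (u v : Fin (n + m)) (t t' : Fin m) (h : (u : ℕ) = i + t)
    (h' : (v : ℕ) = i + t') :
    linkHat N (T.toHomeo _ _ ((insertionHat i).map (𝟙 a ×ₘ y))) u v =
      linkHat N (T.toHomeo _ _ y) t t' := by
  rw [T.map_insertion, T.map_id, linkHat_insertion_inner i _ _ u v t t' h h']

theorem linkHat_pentagon (u v : Fin 4) :
    linkHat N (T.toHomeo _ _ ((insertionHat (n := 2) (m := 2) 0).map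
        (eta.map associator ×ₘ 𝟙 (⟨obj12⟩ : PaBHat 2)))) u v +
      linkHat N (T.toHomeo _ _ ((insertionHat (n := 2) (m := 2) 2).map
        (eta.map associator ×ₘ 𝟙 (⟨obj12⟩ : PaBHat 2)))) u v =
    linkHat N (T.toHomeo _ _ ((insertionHat (n := 1) (m := 3) 0).map
        (𝟙 (⟨obj12⟩ : PaBHat 2) ×ₘ eta.map associator))) u v +
      (linkHat N (T.toHomeo _ _ ((insertionHat (n := 2) (m := 2) 1).map
        (eta.map associator ×ₘ 𝟙 (⟨obj12⟩ : PaBHat 2)))) u v +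
      linkHat N (T.toHomeo _ _ ((insertionHat (n := 1) (m := 3) 1).map
        (𝟙 (⟨obj12⟩ : PaBHat 2) ×ₘ eta.map associator))) u v) := by
  -- Additivity is first stated for an arbitrary pentagon, so that the objects of the actual edges
  -- have to be matched only once.
  have key : ∀ {a b c d e : PaBHat 4} (e₁ : a ⟶ b) (e₂ : b ⟶ c) (e₃ : a ⟶ d) (e₄ : d ⟶ e)
      (e₅ : e ⟶ c), e₁ ≫ e₂ = e₃ ≫ e₄ ≫ e₅ →
      linkHat N (T.toHomeo _ _ e₁) u v + linkHat N (T.toHomeo _ _ e₂) u v =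
      linkHat N (T.toHomeo _ _ e₃) u v + (linkHat N (T.toHomeo _ _ e₄) u v +
        linkHat N (T.toHomeo _ _ e₅) u v) := by
    intro a b c d e e₁ e₂ e₃ e₄ e₅ h
    rw [← linkHat_comp, ← linkHat_comp, ← linkHat_comp, ← T.map_comp, ← T.map_comp,
      ← T.map_comp, h]
  exact key _ _ _ _ _ pentagon

/-- The pentagon equation forces the image of the associator to have trivial linking numbers. -/
theorem linkHat_associator :
    linkHat N (T.toHomeo _ _ (eta.map associator)) 0 1 = 0 ∧
    linkHat N (T.toHomeo _ _ (eta.map associator)) 1 2 = 0 ∧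
    linkHat N (T.toHomeo _ _ (eta.map associator)) 0 2 = 0 := by
  refine ⟨?_, ?_, ?_⟩
  · have h := T.linkHat_pentagon (N := N) 0 1
    rw [T.linkHat_insertion_left (n := 2) (m := 2) 0 _ _ 0 1 0 0 rfl rfl,
      T.linkHat_insertion_left (n := 2) (m := 2) 2 _ _ 0 1 0 1 rfl rfl,
      T.linkHat_insertion_left (n := 2) (m := 2) 1 _ _ 0 1 0 1 rfl rfl,
      T.linkHat_insertion_right_inner (n := 1) (m := 3) 0 _ _ 0 1 0 1 rfl rfl,
      T.linkHat_insertion_right_outer (n := 1) (m := 3) 1 _ _ 0 1 0 1 rfl rfl (by decide)] at h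
    simpa using h
  · have h := T.linkHat_pentagon (N := N) 2 3
    rw [T.linkHat_insertion_left (n := 2) (m := 2) 0 _ _ 2 3 1 2 rfl rfl,
      T.linkHat_insertion_left (n := 2) (m := 2) 2 _ _ 2 3 2 2 rfl rfl,
      T.linkHat_insertion_left (n := 2) (m := 2) 1 _ _ 2 3 1 2 rfl rfl,
      T.linkHat_insertion_right_outer (n := 1) (m := 3) 0 _ _ 2 3 0 1 rfl rfl (by decide),
      T.linkHat_insertion_right_inner (n := 1) (m := 3) 1 _ _ 2 3 1 2 rfl rfl] at h
    simpa using h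
  · have h := T.linkHat_pentagon (N := N) 0 3
    rw [T.linkHat_insertion_left (n := 2) (m := 2) 0 _ _ 0 3 0 2 rfl rfl,
      T.linkHat_insertion_left (n := 2) (m := 2) 2 _ _ 0 3 0 2 rfl rfl,
      T.linkHat_insertion_left (n := 2) (m := 2) 1 _ _ 0 3 0 2 rfl rfl,
      T.linkHat_insertion_right_outer (n := 1) (m := 3) 0 _ _ 0 3 0 1 rfl rfl (by decide),
      T.linkHat_insertion_right_outer (n := 1) (m := 3) 1 _ _ 0 3 0 1 rfl rfl (by decide)] at h
    simpa using h

/-- The second component of the pair of an element of the Grothendieck–Teichmüller group has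
trivial linking numbers. -/
theorem linkHat_pair :
    linkHat N T.pair.2 0 1 = 0 ∧ linkHat N T.pair.2 1 2 = 0 ∧ linkHat N T.pair.2 0 2 = 0 := by
  -- The second component is the image of the associator followed by the inverse associator, and the
  -- latter is a trivial braid.
  have h : ∀ i j, linkHat N T.pair.2 i j =
      linkHat N (T.toHomeo _ _ (eta.map associator)) i j := by
    intro i j
    have e : linkHat N (eta.map associator) i j = 0 := by
      rw [linkHat_eta, PaB.linking, associator, PaB.ou_mkHom, link_one, Int.cast_zero]
    have e' : linkHat N (Groupoid.inv (eta.map associator)) i j = 0 :=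
      (linkHat_inv _ i j).trans (by rw [e, neg_zero])
    exact (linkHat_comp _ _ i j).trans ((congrArg _ e').trans (add_zero _))
  simpa only [h] using T.linkHat_associator

end GTHat

/-! ## The pure braid group on three strands -/

/-- If the subgroup `K` contains `a ^ 2` and is stable under conjugation by `a`, then left
multiplication by `a` preserves `K · {1, a, b, a b, b a, a b a}`. -/
theorem exists_mul_representative {G : Type*} [Group G] {K : Subgroup G} {a b : G}
    (ha : a ^ 2 ∈ K) (hconj : ∀ κ ∈ K, a * κ * a⁻¹ ∈ K) {x : G}
    (hx : ∃ κ ∈ K, ∃ t ∈ ({1, a, b, a * b, b * a, a * b * a} : Set G), x = κ * t) :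
    ∃ κ ∈ K, ∃ t ∈ ({1, a, b, a * b, b * a, a * b * a} : Set G), a * x = κ * t := by
  obtain ⟨κ, hκ, t, ht, rfl⟩ := hx
  have h : ∃ κ' ∈ K, ∃ t' ∈ ({1, a, b, a * b, b * a, a * b * a} : Set G), a * t = κ' * t' := by
    simp only [Set.mem_insert_iff, Set.mem_singleton_iff] at ht
    rcases ht with rfl | rfl | rfl | rfl | rfl | rfl
    · exact ⟨1, K.one_mem, a, by simp, by group⟩
    · exact ⟨t ^ 2, ha, 1, by simp, by rw [mul_one, pow_two]⟩
    · exact ⟨1, K.one_mem, a * t, by simp, by group⟩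
    · exact ⟨a ^ 2, ha, b, by simp, by rw [pow_two, mul_assoc]⟩
    · exact ⟨1, K.one_mem, a * b * a, by simp, by group⟩
    · exact ⟨a ^ 2, ha, b * a, by simp, by simp only [pow_two, mul_assoc]⟩
  obtain ⟨κ', hκ', t', ht', e⟩ := h
  -- `a κ t = (a κ a⁻¹)(a t)`, and both `a κ a⁻¹` and the coefficient `κ'` of `a t` lie in `K`.
  exact ⟨a * κ * a⁻¹ * κ', K.mul_mem (hconj κ hκ) hκ', t', ht', by
    rw [mul_assoc, ← e]; group⟩

/-- The square of the half twist on three strands. -/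
def fullTwist : Braid 3 := (sigma 3 0 * sigma 3 1 * sigma 3 0) ^ 2

theorem sigma_three_near : sigma 3 0 * sigma 3 1 * sigma 3 0 = sigma 3 1 * sigma 3 0 * sigma 3 1 :=
  (sigma_isBraiding 3).near 0 (by norm_num)

/-- Moving the half twist past a generator exchanges the two generators (`h0`, `h1`), so its square
commutes with both. -/
theorem fullTwist_comm (g : Braid 3) : fullTwist * g = g * fullTwist := by
  have h := sigma_three_near
  have h0 : sigma 3 0 * sigma 3 1 * sigma 3 0 * sigma 3 0 =
      sigma 3 1 * (sigma 3 0 * sigma 3 1 * sigma 3 0) := by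
    calc _ = sigma 3 1 * sigma 3 0 * sigma 3 1 * sigma 3 0 := by rw [h]
      _ = _ := by simp only [mul_assoc]
  have h1 : sigma 3 0 * sigma 3 1 * sigma 3 0 * sigma 3 1 =
      sigma 3 0 * (sigma 3 0 * sigma 3 1 * sigma 3 0) := by
    calc _ = sigma 3 0 * (sigma 3 1 * sigma 3 0 * sigma 3 1) := by simp only [mul_assoc]
      _ = _ := by rw [h]
  induction g using Braid.induction with
  | one => simp
  | gen j hj =>
    have : j = 0 ∨ j = 1 := by omega
    rcases this with rfl | rfl
    · rw [fullTwist, pow_two, mul_assoc, h0, ← mul_assoc, h1]; simp only [mul_assoc]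
    · rw [fullTwist, pow_two, mul_assoc, h1, ← mul_assoc, h0]; simp only [mul_assoc]
  | mul g h hg hh => rw [← mul_assoc, hg, mul_assoc, hh, mul_assoc]
  | inv g hg => rw [eq_inv_mul_iff_mul_eq, ← mul_assoc, ← hg, mul_inv_cancel_right]

/-- The subgroup of `B_3` generated by `x₁₂`, `x₂₃` and the full twist. -/
def twistSubgroup : Subgroup (Braid 3) :=
  Subgroup.closure {sigma 3 0 ^ 2, sigma 3 1 ^ 2, fullTwist}

theorem sigma_zero_sq_mem : sigma 3 0 ^ 2 ∈ twistSubgroup :=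
  Subgroup.subset_closure (by simp)

theorem sigma_one_sq_mem : sigma 3 1 ^ 2 ∈ twistSubgroup :=
  Subgroup.subset_closure (by simp)

theorem fullTwist_mem : fullTwist ∈ twistSubgroup :=
  Subgroup.subset_closure (by simp)

/-- It suffices to conjugate the three generators of the subgroup. Two of them commute with `sigma 3
0`; the conjugate of $\sigma_2^2$ is expressed through the central full twist. -/
theorem sigma_zero_conj_mem : ∀ κ ∈ twistSubgroup,
    sigma 3 0 * κ * (sigma 3 0)⁻¹ ∈ twistSubgroup := by
  have hle : twistSubgroup ≤ twistSubgroup.comap (MulAut.conj (sigma 3 0)).toMonoidHom := by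
    rw [twistSubgroup, Subgroup.closure_le]
    rintro g (rfl | rfl | rfl)
    · change sigma 3 0 * sigma 3 0 ^ 2 * (sigma 3 0)⁻¹ ∈ twistSubgroup
      convert sigma_zero_sq_mem using 1
      group
    · change sigma 3 0 * sigma 3 1 ^ 2 * (sigma 3 0)⁻¹ ∈ twistSubgroup
      have e : fullTwist = sigma 3 1 * (sigma 3 0 * sigma 3 1 ^ 2 * sigma 3 0) * sigma 3 1 := by
        rw [fullTwist, sigma_three_near]; simp only [pow_two, mul_assoc]
      -- By `e` and the centrality of the full twist $c$, $\sigma_1\sigma_2^2\sigma_1 =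
      -- \sigma_2^{-1} c\,\sigma_2^{-1} = c\,\sigma_2^{-2}$; multiplication by $\sigma_1^{-2}$ on
      -- the right gives the claim.
      have e' : sigma 3 0 * sigma 3 1 ^ 2 * (sigma 3 0)⁻¹ =
          fullTwist * (sigma 3 1 ^ 2)⁻¹ * (sigma 3 0 ^ 2)⁻¹ := by
        have h2 : fullTwist * (sigma 3 1)⁻¹ = (sigma 3 1)⁻¹ * fullTwist := fullTwist_comm _
        have h3 : fullTwist * (sigma 3 1 ^ 2)⁻¹ = (sigma 3 1)⁻¹ * fullTwist * (sigma 3 1)⁻¹ := by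
          rw [← h2]; group
        rw [h3, e]; group
      rw [e']
      exact mul_mem (mul_mem fullTwist_mem (inv_mem sigma_one_sq_mem)) (inv_mem sigma_zero_sq_mem)
    · change sigma 3 0 * fullTwist * (sigma 3 0)⁻¹ ∈ twistSubgroup
      rw [← fullTwist_comm, mul_inv_cancel_right]
      exact fullTwist_mem
  exact hle

theorem sigma_one_conj_mem : ∀ κ ∈ twistSubgroup,
    sigma 3 1 * κ * (sigma 3 1)⁻¹ ∈ twistSubgroup := by
  have hle : twistSubgroup ≤ twistSubgroup.comap (MulAut.conj (sigma 3 1)).toMonoidHom := by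
    rw [twistSubgroup, Subgroup.closure_le]
    rintro g (rfl | rfl | rfl)
    · change sigma 3 1 * sigma 3 0 ^ 2 * (sigma 3 1)⁻¹ ∈ twistSubgroup
      have e : fullTwist = sigma 3 0 * (sigma 3 1 * sigma 3 0 ^ 2 * sigma 3 1) * sigma 3 0 := by
        rw [fullTwist]; simp only [pow_two, mul_assoc]
      have e' : sigma 3 1 * sigma 3 0 ^ 2 * (sigma 3 1)⁻¹ =
          fullTwist * (sigma 3 0 ^ 2)⁻¹ * (sigma 3 1 ^ 2)⁻¹ := by
        have h2 : fullTwist * (sigma 3 0)⁻¹ = (sigma 3 0)⁻¹ * fullTwist := fullTwist_comm _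
        have h3 : fullTwist * (sigma 3 0 ^ 2)⁻¹ = (sigma 3 0)⁻¹ * fullTwist * (sigma 3 0)⁻¹ := by
          rw [← h2]; group
        rw [h3, e]; group
      rw [e']
      exact mul_mem (mul_mem fullTwist_mem (inv_mem sigma_zero_sq_mem)) (inv_mem sigma_one_sq_mem)
    · change sigma 3 1 * sigma 3 1 ^ 2 * (sigma 3 1)⁻¹ ∈ twistSubgroup
      convert sigma_one_sq_mem using 1
      group
    · change sigma 3 1 * fullTwist * (sigma 3 1)⁻¹ ∈ twistSubgroup
      rw [← fullTwist_comm, mul_inv_cancel_right]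
      exact fullTwist_mem
  exact hle

/-- Every braid on three strands is, modulo the subgroup generated by `x₁₂`, `x₂₃` and the full
twist, one of the six standard permutation braids. -/
theorem exists_representative (g : Braid 3) : ∃ κ ∈ twistSubgroup,
    ∃ t ∈ ({1, sigma 3 0, sigma 3 1, sigma 3 0 * sigma 3 1, sigma 3 1 * sigma 3 0,
      sigma 3 0 * sigma 3 1 * sigma 3 0} : Set (Braid 3)), g = κ * t := by
  set a := sigma 3 0 with ha
  set b := sigma 3 1 with hb
  let P : Braid 3 → Prop := fun g => ∃ κ ∈ twistSubgroup,
    ∃ t ∈ ({1, a, b, a * b, b * a, a * b * a} : Set (Braid 3)), g = κ * t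
  have hmul : ∀ κ ∈ twistSubgroup, ∀ x, P x → P (κ * x) := by
    rintro κ hκ x ⟨κ', hκ', t, ht, rfl⟩
    exact ⟨κ * κ', mul_mem hκ hκ', t, ht, (mul_assoc _ _ _).symm⟩
  have hPa : ∀ x, P x → P (a * x) := fun x =>
    exists_mul_representative sigma_zero_sq_mem sigma_zero_conj_mem
  -- Exchanging `a` and `b` preserves the set of representatives because of the braid relation, so
  -- the lemma for `a` also applies to `b`.
  have hset : ({1, b, a, b * a, a * b, b * a * b} : Set (Braid 3)) =
      {1, a, b, a * b, b * a, a * b * a} := by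
    rw [← sigma_three_near]
    ext x
    simp only [Set.mem_insert_iff, Set.mem_singleton_iff]
    tauto
  have hPb : ∀ x, P x → P (b * x) := fun x => by
    have := exists_mul_representative (x := x) (b := a) sigma_one_sq_mem sigma_one_conj_mem
    rwa [hset] at this
  -- An equivalence rather than an implication, so that the induction passes to inverses.
  have hP : ∀ x, P x ↔ P (g * x) := by
    induction g using Braid.induction with
    | one => simp
    | gen j hj =>
      intro x
      have : j = 0 ∨ j = 1 := by omega
      rcases this with rfl | rfl
      · refine ⟨hPa x, fun h => ?_⟩
        -- Left multiplication by `a⁻¹` is left multiplication by `a` followed by that by `a⁻²`,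
        -- which lies in the subgroup.
        have := hmul _ (inv_mem sigma_zero_sq_mem) _ (hPa _ h)
        rwa [← ha, pow_two, mul_inv_rev, mul_assoc, inv_mul_cancel_left,
          inv_mul_cancel_left] at this
      · refine ⟨hPb x, fun h => ?_⟩
        have := hmul _ (inv_mem sigma_one_sq_mem) _ (hPb _ h)
        rwa [← hb, pow_two, mul_inv_rev, mul_assoc, inv_mul_cancel_left,
          inv_mul_cancel_left] at this
    | mul g h hg hh => intro x; rw [hh, hg, mul_assoc]
    | inv g hg => intro x; rw [hg (g⁻¹ * x), mul_inv_cancel_left]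
  have := (hP 1).1 ⟨1, one_mem _, 1, by simp, by simp⟩
  rwa [mul_one] at this

theorem fullTwist_pure : fullTwist ∈ PureBraid 3 := by
  rw [PureBraid, MonoidHom.mem_ker, fullTwist, map_pow, map_mul, map_mul, braidPerm,
    Braid.lift_sigma _ _ (by norm_num), Braid.lift_sigma _ _ (by norm_num)]
  decide

/-- The full twist as a pure braid. -/
def pureTwist : PureBraid 3 := ⟨fullTwist, fullTwist_pure⟩

/-- The full twist is central, so its powers can be collected on the right of any word in the
generators. -/
theorem exists_of_mem_twistSubgroup {κ : Braid 3} (h : κ ∈ twistSubgroup) :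
    ∃ (v : FreeGroup (Fin 2)) (k : ℤ), κ = (freeToPure v * pureTwist ^ k : PureBraid 3) := by
  have hcomm : ∀ (g : PureBraid 3) (k : ℤ), pureTwist ^ k * g = g * pureTwist ^ k := fun g k =>
    (Commute.zpow_left (Subtype.ext (fullTwist_comm g.1) : Commute pureTwist g) k).eq
  induction h using Subgroup.closure_induction with
  | mem x hx =>
    rcases hx with rfl | rfl | rfl
    · exact ⟨FreeGroup.of 0, 0, by simp [freeToPure, x12]⟩
    · exact ⟨FreeGroup.of 1, 0, by simp [freeToPure, x23]⟩
    · exact ⟨1, 1, by simp [pureTwist]⟩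
  | one => exact ⟨1, 0, by simp⟩
  | mul x y _ _ hx hy =>
    obtain ⟨v, k, rfl⟩ := hx
    obtain ⟨w, l, rfl⟩ := hy
    refine ⟨v * w, k + l, ?_⟩
    rw [← Subgroup.coe_mul, map_mul, zpow_add]
    congr 1
    rw [mul_assoc, ← mul_assoc (pureTwist ^ k), hcomm]
    simp only [mul_assoc]
  | inv x _ hx =>
    obtain ⟨v, k, rfl⟩ := hx
    refine ⟨v⁻¹, -k, ?_⟩
    rw [← Subgroup.coe_inv, map_inv, mul_inv_rev, zpow_neg]
    congr 1
    rw [← zpow_neg, hcomm]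

/-- Every pure braid on three strands is the product of an element of the subgroup generated by
`x₁₂` and `x₂₃` and a power of the full twist. -/
theorem exists_freeToPure_mul (w : PureBraid 3) :
    ∃ (v : FreeGroup (Fin 2)) (k : ℤ), w = freeToPure v * pureTwist ^ k := by
  obtain ⟨κ, hκ, t, ht, e⟩ := exists_representative w.1
  obtain ⟨v, k, rfl⟩ := exists_of_mem_twistSubgroup hκ
  -- Both `w` and the factor in the twist subgroup are pure, so the representative is pure as well.
  have hp : braidPerm 3 t = 1 := by
    have h := congrArg (braidPerm 3) e
    rw [map_mul, show braidPerm 3 w.1 = 1 from w.2,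
      show braidPerm 3 (freeToPure v * pureTwist ^ k : PureBraid 3) = 1 from
        (freeToPure v * pureTwist ^ k).2, one_mul] at h
    exact h.symm
  -- Of the six representatives only the trivial one has trivial permutation.
  have h1 : t = 1 := by
    have e0 : braidPerm 3 (sigma 3 0) = adjSwap 3 0 := Braid.lift_sigma _ _ (by norm_num)
    have e1 : braidPerm 3 (sigma 3 1) = adjSwap 3 1 := Braid.lift_sigma _ _ (by norm_num)
    simp only [Set.mem_insert_iff, Set.mem_singleton_iff] at ht
    rcases ht with rfl | rfl | rfl | rfl | rfl | rfl
    · rfl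
    all_goals
      simp only [map_mul, e0, e1] at hp
      exact absurd hp (by decide)
  exact ⟨v, k, Subtype.ext (by rw [e, h1, mul_one])⟩

/-! ### Linking numbers of pure braids -/

/-- The linking number of two strands of a pure braid, as a homomorphism. -/
def pureLink (n : ℕ) (p q : Fin n) : PureBraid n →* Multiplicative ℤ where
  toFun g := Multiplicative.ofAdd (link n g p q)
  map_one' := by simp
  map_mul' g h := by
    -- A pure braid returns every strand to its position, so the cocycle rule becomes
    -- multiplicativity.
    rw [Subgroup.coe_mul, link_mul, show braidPerm n h.1 = 1 from h.2]
    rfl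

/-- Crossings are counted without halving, so a full turn of two strands counts `2`. This is the
source of the modulus `2 * N` below. -/
theorem pureLink_x12 : pureLink 3 0 1 x12 = Multiplicative.ofAdd 2 ∧
    pureLink 3 1 2 x12 = 1 ∧ pureLink 3 0 2 x12 = 1 := by
  simp only [pureLink, MonoidHom.coe_mk, OneHom.coe_mk, x12, pow_two, link_mul,
    link_sigma (show 0 + 1 < 3 by norm_num), braidPerm_sigma_val (show 0 + 1 < 3 by norm_num)]
  decide

theorem pureLink_x23 : pureLink 3 0 1 x23 = 1 ∧
    pureLink 3 1 2 x23 = Multiplicative.ofAdd 2 ∧ pureLink 3 0 2 x23 = 1 := by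
  simp only [pureLink, MonoidHom.coe_mk, OneHom.coe_mk, x23, pow_two, link_mul,
    link_sigma (show 1 + 1 < 3 by norm_num), braidPerm_sigma_val (show 1 + 1 < 3 by norm_num)]
  decide

/-- In the full twist every two strands make one full turn. It is the only one of the three
generators that links the outer strands, so that pair detects its exponent. -/
theorem pureLink_pureTwist : pureLink 3 0 1 pureTwist = Multiplicative.ofAdd 2 ∧
    pureLink 3 1 2 pureTwist = Multiplicative.ofAdd 2 ∧
    pureLink 3 0 2 pureTwist = Multiplicative.ofAdd 2 := by
  simp only [pureLink, MonoidHom.coe_mk, OneHom.coe_mk, pureTwist, fullTwist, pow_two, link_mul,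
    map_mul, Equiv.Perm.mul_apply, link_sigma (show 0 + 1 < 3 by norm_num),
    link_sigma (show 1 + 1 < 3 by norm_num), braidPerm_sigma_val (show 0 + 1 < 3 by norm_num),
    braidPerm_sigma_val (show 1 + 1 < 3 by norm_num)]
  decide

/-- Every element of the free group on two generators is of the form `x ^ p * y ^ q * v` with `v`
in the commutator subgroup. -/
theorem exists_commutator_mul (v : FreeGroup (Fin 2)) : ∃ (p q : ℤ),
    ∃ v' ∈ commutator (FreeGroup (Fin 2)), v = FreeGroup.of 0 ^ p * FreeGroup.of 1 ^ q * v' := by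
  -- In the abelianization the two generators commute, so exponents can be collected.
  have key : ∃ p q : ℤ, Abelianization.of v =
      Abelianization.of (FreeGroup.of 0) ^ p * Abelianization.of (FreeGroup.of 1) ^ q := by
    induction v using FreeGroup.induction_on with
    | C1 => exact ⟨0, 0, by simp⟩
    | of i =>
      fin_cases i
      · exact ⟨1, 0, by simp⟩
      · exact ⟨0, 1, by simp⟩
    | inv_of i hi =>
      obtain ⟨p, q, h⟩ := hi
      exact ⟨-p, -q, by rw [map_inv, h, mul_inv, zpow_neg, zpow_neg]⟩
    | mul v w hv hw =>
      obtain ⟨p, q, h⟩ := hv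
      obtain ⟨p', q', h'⟩ := hw
      exact ⟨p + p', q + q', by rw [map_mul, h, h', zpow_add, zpow_add, mul_mul_mul_comm]⟩
  obtain ⟨p, q, h⟩ := key
  refine ⟨p, q, (FreeGroup.of 0 ^ p * FreeGroup.of 1 ^ q)⁻¹ * v, ?_, by group⟩
  rw [← Abelianization.ker_of, MonoidHom.mem_ker, map_mul, map_inv, map_mul, map_zpow, map_zpow, h,
    inv_mul_cancel]

/-- If all linking numbers of a pure braid on three strands are divisible by `2 N`, then the braid
is congruent, modulo a normal subgroup that contains all `N`-th powers, to an element of the image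
of the commutator subgroup of the free group. -/
theorem exists_commutator_of_pureLink {N : ℕ} (K : Subgroup (PureBraid 3)) [K.Normal]
    (hK : ∀ g : PureBraid 3, g ^ N ∈ K) (w : PureBraid 3)
    (h01 : ((2 * N : ℕ) : ℤ) ∣ (pureLink 3 0 1 w).toAdd)
    (h12 : ((2 * N : ℕ) : ℤ) ∣ (pureLink 3 1 2 w).toAdd)
    (h02 : ((2 * N : ℕ) : ℤ) ∣ (pureLink 3 0 2 w).toAdd) :
    ∃ v ∈ commutator (FreeGroup (Fin 2)), (freeToPure v)⁻¹ * w ∈ K := by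
  obtain ⟨u, k, rfl⟩ := exists_freeToPure_mul w
  obtain ⟨p, q, v, hv, rfl⟩ := exists_commutator_mul u
  refine ⟨v, hv, ?_⟩
  -- The target is abelian, so crossing numbers do not see the commutator part.
  have hv1 : ∀ φ : FreeGroup (Fin 2) →* Multiplicative ℤ, φ v = 1 := fun φ =>
    Abelianization.commutator_subset_ker φ hv
  have h0 : freeToPure (FreeGroup.of 0) = x12 := by simp [freeToPure]
  have h1 : freeToPure (FreeGroup.of 1) = x23 := by simp [freeToPure]
  have e : ∀ i j, pureLink 3 i j (freeToPure v) = 1 := fun i j =>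
    hv1 ((pureLink 3 i j).comp freeToPure)
  simp only [map_mul, map_zpow, h0, h1, e, pureLink_x12, pureLink_x23, pureLink_pureTwist,
    one_zpow, one_mul, mul_one, toAdd_mul, toAdd_zpow, toAdd_ofAdd, smul_eq_mul] at h01 h12 h02
  push_cast at h01 h12 h02
  -- The hypotheses now say that `2 N` divides `2 p + 2 k`, `2 q + 2 k` and `2 k`; the last one
  -- gives `k`, and then the others give `p` and `q`.
  have hk : (N : ℤ) ∣ k := by
    rw [mul_comm k] at h02
    exact (mul_dvd_mul_iff_left two_ne_zero).1 h02
  have hp : (N : ℤ) ∣ p := by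
    rw [← add_mul, mul_comm _ (2 : ℤ)] at h01
    exact (dvd_add_left hk).1 ((mul_dvd_mul_iff_left two_ne_zero).1 h01)
  have hq : (N : ℤ) ∣ q := by
    rw [← add_mul, mul_comm _ (2 : ℤ)] at h12
    exact (dvd_add_left hk).1 ((mul_dvd_mul_iff_left two_ne_zero).1 h12)
  have hpow : ∀ (g : PureBraid 3) (z : ℤ), (N : ℤ) ∣ z → (g ^ z : PureBraid 3) ∈ K := by
    rintro g z ⟨d, rfl⟩
    rw [zpow_mul, zpow_natCast]
    exact K.zpow_mem (hK g) d
  -- Modulo `K` the three powers become trivial, and what remains is the commutator part times its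
  -- inverse.
  rw [← QuotientGroup.eq_one_iff]
  have t : ∀ (g : PureBraid 3) (z : ℤ), (N : ℤ) ∣ z →
      ((g ^ z : PureBraid 3) : PureBraid 3 ⧸ K) = 1 :=
    fun g z hz => (QuotientGroup.eq_one_iff _).2 (hpow g z hz)
  rw [QuotientGroup.mk_mul, map_mul, map_mul, map_zpow, map_zpow, QuotientGroup.mk_mul,
    QuotientGroup.mk_mul, QuotientGroup.mk_mul, t _ _ hk, t _ _ hp, t _ _ hq, QuotientGroup.mk_inv]
  simp

/-! ## Conclusion -/

/-- If the components of an automorphism of the profinite completion of a groupoid all come from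
elements of a subgroup `S`, then the automorphism is the image of an element of any closed subgroup
that contains the image of `S` in the profinite completion. -/
theorem mem_map_extend_of_forall_component {G : Type} [Groupoid.{0} G] [Finite G] {A : Type}
    [Group A] {a : G} (φ : A →* End a) (S : Subgroup A) (f : End (⟨a⟩ : ProCompletion G))
    (C : Subgroup (ProfiniteGrp.ProfiniteCompletion.completion (GrpCat.of A)))
    (hC : IsClosed (C : Set (ProfiniteGrp.ProfiniteCompletion.completion (GrpCat.of A))))
    (hS : ∀ s ∈ S, ProfiniteGrp.ProfiniteCompletion.etaFn (GrpCat.of A) s ∈ C)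
    (h : ∀ R : CompatRel G, ∃ s ∈ S, component f R = ⟦φ s⟧) :
    f ∈ C.map (extend φ) := by
  -- `t R` collects the elements of `C` that are correct in the quotient by `R`. These sets are
  -- closed, nonempty and directed under refinement, so by compactness of the profinite completion
  -- they have a common point.
  let t : CompatRel G → Set (ProfiniteGrp.ProfiniteCompletion.completion (GrpCat.of A)) :=
    fun R => {ξ | ξ ∈ C ∧ component (extend φ ξ : (⟨a⟩ : ProCompletion G) ⟶ ⟨a⟩) R = component f R}
  have htcl : ∀ R, IsClosed (t R) := by
    intro R
    refine hC.inter ?_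
    have hcont : Continuous fun ξ : ProfiniteGrp.ProfiniteCompletion.completion (GrpCat.of A) =>
        ξ.1 (FiniteIndexNormalSubgroup.ofSubgroup (kernel φ R)) :=
      (continuous_apply _).comp continuous_subtype_val
    -- The condition at `R` involves only one coordinate of the limit, in a discrete group, so it is
    -- closed.
    have hd : DiscreteTopology ((ProfiniteGrp.ProfiniteCompletion.diagram (GrpCat.of A)).obj
      (FiniteIndexNormalSubgroup.ofSubgroup (kernel φ R))) := ⟨rfl⟩
    exact (@isClosed_discrete _ _ hd
      {y : A ⧸ kernel φ R | kernelMap φ R y = component f R}).preimage hcont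
  have htn : ∀ R, (t R).Nonempty := by
    intro R
    obtain ⟨s, hs, e⟩ := h R
    exact ⟨_, hS s hs, e.symm⟩
  -- Identifying all parallel morphisms is a compatible relation, as there are finitely many
  -- objects. The intersection argument needs a nonempty index set, and membership in `C` is read
  -- off at one index.
  have : Nonempty (CompatRel G) := ⟨{
    rel := fun _ _ => ⊤
    comp_left := fun _ _ _ _ => trivial
    comp_right := fun _ _ => trivial
    finite := by
      have (p : G × G) : Subsingleton (Quotient (⊤ : Setoid (p.1 ⟶ p.2))) :=
        ⟨by rintro ⟨x⟩ ⟨y⟩; exact Quotient.sound (s := ⊤) trivial⟩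
      infer_instance }⟩
  obtain ⟨ξ, hξ⟩ := IsCompact.nonempty_iInter_of_directed_nonempty_isCompact_isClosed t
    (fun R S => ⟨R ⊓ S, fun ξ hξ => ⟨hξ.1, by
      rw [← proj_component _ (CompatRel.min_le_left R S), hξ.2, proj_component]⟩,
      fun ξ hξ => ⟨hξ.1, by
      rw [← proj_component _ (CompatRel.min_le_right R S), hξ.2, proj_component]⟩⟩)
    htn (fun R => (htcl R).isCompact) htcl
  rw [Set.mem_iInter] at hξ
  exact ⟨ξ, (hξ (Classical.arbitrary _)).1, hom_ext fun R => (hξ R).2⟩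

/-- In every finite quotient, `f̂` comes from the commutator subgroup of the free group. -/
theorem GTHat.exists_commutator_component (T : GTHat) (R : CompatRel (PaB 3)) :
    ∃ v ∈ commutator (FreeGroup (Fin 2)),
      component T.pair.2 R = ⟦PaB.pureEnd obj12_3 (freeToPure v)⟧ := by
  set φ := (PaB.pureEnd obj12_3).toMonoidHom
  -- Every `N`-th power lies in a normal subgroup of index `N`.
  let N := (kernel φ R).index
  have : NeZero N := ⟨Subgroup.FiniteIndex.index_ne_zero⟩
  -- One braid represents the second component both modulo `R` and for crossing numbers modulo `2 *
  -- N`.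
  obtain ⟨g, hg⟩ := Quotient.exists_rep (component T.pair.2 (R ⊓ linkRel 3 (2 * N)))
  obtain ⟨w, rfl⟩ := (PaB.pureEnd obj12_3).surjective g
  have hR := component_eq_of_le (CompatRel.min_le_left _ _) hg.symm
  have hL := linkHat_of_component (component_eq_of_le (CompatRel.min_le_right _ _) hg.symm)
  obtain ⟨h01, h12, h02⟩ := T.linkHat_pair (N := 2 * N)
  rw [hL, ZMod.intCast_zmod_eq_zero_iff_dvd] at h01 h12 h02
  -- In (1 2) 3 each label stands at the position with the same number, so crossing numbers by label
  -- and by position coincide by evaluation.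
  obtain ⟨v, hv, h⟩ := exists_commutator_of_pureLink (kernel φ R)
    (fun g => (kernel φ R).pow_index_mem g) w h01 h12 h02
  exact ⟨v, hv, hR.trans (Quotient.sound (s := R.rel _ _)
    (Setoid.symm' _ ((rel_of_inv_mul_mem φ R).1 h)))⟩

theorem etaFn_mem_topologicalClosure {A : Type} [Group A] {s : A} (h : s ∈ commutator A) :
    ProfiniteGrp.ProfiniteCompletion.etaFn (GrpCat.of A) s ∈
      (commutator (ProfiniteGrp.ProfiniteCompletion.completion
        (GrpCat.of A))).topologicalClosure := by
  refine Subgroup.le_topologicalClosure _ ?_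
  have := Subgroup.mem_map_of_mem (ProfiniteGrp.ProfiniteCompletion.eta (GrpCat.of A)).hom h
  rw [commutator_def, Subgroup.map_commutator] at this
  exact Subgroup.commutator_mono le_top le_top this

end GTHatPaB

theorem corollary2p19
    (m : CategoryTheory.End (⟨GTHatPaB.obj12⟩ : GTHatPaB.PaBHat 2))
    (f : CategoryTheory.End (⟨GTHatPaB.obj12_3⟩ : GTHatPaB.PaBHat 3))
    (h : (m, f) ∈ Set.range GTHatPaB.GTHat.pair) :
    f ∈ (commutator GTHatPaB.F2Hat).topologicalClosure.map GTHatPaB.F2Hat.toPure := by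
  obtain ⟨T, hT⟩ := h
  obtain rfl : T.pair.2 = f := congrArg Prod.snd hT
  -- The discrete commutator subgroup supplies the approximations, and the closed commutator
  -- subgroup of the completion contains its image.
  exact GTHatPaB.mem_map_extend_of_forall_component _ (commutator (FreeGroup (Fin 2))) _ _
    (Subgroup.isClosed_topologicalClosure _) (fun s hs => GTHatPaB.etaFn_mem_topologicalClosure hs)
    T.exists_commutator_component
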